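/- Let $a=2\cos\frac{2\pi}{5}$, $b=2\cos\frac{\pi}{5}$, $f(\xi)=\xi^8(\xi-a)^3(\xi-b)^9$, and let $S_{\mathrm{reg}}=\{(\xi,\eta)\in\mathbb{C}^2 : \eta^{10}=f(\xi)\}\setminus\{(0,0),(a,0),(b,0)\}$. Let $T$ be the closed triangle with vertices $O=0$, $A=a$, $B=b\,e^{i\pi/5}$, and $T^{*}=T\setminus\{O,A,B\}$ with the Euclidean metric $\gamma$. On the closed upper half plane $\mathbb{C}^+$ let $\eta$ denote the branch of $f^{1/10}$ that is positive on $(0,a)$, let $k=a/\int_0^a \frac{d\xi}{\eta}>0$, and let $F_T(\xi)=k\int_0^{\xi}\frac{d\xi}{\eta}$. Let $\delta(\xi,\eta)=F_T(\xi)$ on the part $S^{+}_{\mathrm{reg}}$ of $S_{\mathrm{reg}}$ with $\operatorname{Im}\xi\ge 0$. Equip $S_{\mathrm{reg}}$ with the Riemannian metric $\Gamma=\frac{k}{\eta}d\xi\odot\overline{\frac{k}{\eta}d\xi}$. Then: 1. $T^*$ is bounded, $\lim_{\xi\to\infty,\ \xi\in\mathbb{C}^+}F_T(\xi)=P$ exists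 and lies in the open edge $OB$, $\delta(S^{+}_{\mathrm{reg}})=T^*\setminus\{P\}$, and $\delta$ is a local isometry: at every point of $S^+_{\mathrm{reg}}$ its differential carries $\Gamma$ to $\gamma$. 2. Geodesics correspond to straight segments. A continuous curve $c:J\to S^{+}_{\mathrm{reg}}$ on an open interval $J$ is a geodesic of $(S_{\mathrm{reg}},\Gamma)$ if and only if $\delta\circ c$ is a uniformly traversed straight segment $t\mapsto z_0+t\alpha$ in $T^*$. On all of $S_{\mathrm{reg}}$ the same holds for the local determinations of $\delta$: if $V\subseteq\mathbb{C}$ is open and $D:V\to\mathbb{C}$ is holomorphic with $(D')^{10}f=k^{10}$ on $V$ (that is, $dD=k\,d\xi/\eta$ for some tenth root $\eta$ of $f$), then a continuous curve $c=(\xi,\eta):J\to S_{\mathrm{reg}}$ with $\xi(J)\subseteq V$ is a geodesic if and only if $D\circ\xi$ is of the form $t\mapsto z_0+t\alpha$; and for every $p=(\xi_0,\eta_0)\in S_{\mathrm{reg}}$ with $\xi_0\in V$ and every $\alpha\in\mathbb{C}$ there are $\varepsilon>0$ and a geodesic $c=(\xi,\eta):(-\varepsilon,\varepsilon)\to S_{\mathrm{reg}}$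 with $c(0)=p$, $\xi(t)\in V$ and $D(\xi(t))=D(\xi_0)+t\alpha$ for all $t$. 3. The geodesic vector field on $(S_{\mathrm{reg}},\Gamma)$ is incomplete: it has a maximal integral curve that is not defined for all times $t\in\mathbb{R}$. -/

import Mathlib

open Set Filter Topology
open scoped Real InnerProductSpace Gradient

noncomputable section

namespace Icosa

/-! ### The triangle and the affine Riemann surface -/

/-- The side length `|OA| = 2 cos (2π/5)`. -/
def a : ℝ := 2 * Real.cos (2 * π / 5)

/-- The side length `|OB| = 2 cos (π/5)`. -/
def b : ℝ := 2 * Real.cos (π / 5)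

/-- The vertex `A` of the triangle, on the positive real axis. -/
def ptA : ℂ := (a : ℂ)

/-- The vertex `B` of the triangle: `|OB| = b` and the angle `AOB` is `π/5`. -/
def ptB : ℂ := (b : ℂ) * Complex.exp ((π / 5 : ℝ) * Complex.I)

/-- The closed triangle `T` with vertices `O = 0`, `A`, `B`. -/
def T : Set ℂ := convexHull ℝ {0, ptA, ptB}

/-- `T* = T ∖ {O, A, B}`. -/
def Tstar : Set ℂ := T \ {0, ptA, ptB}

/-- `f ξ = ξ⁸ (ξ - a)³ (ξ - b)⁹`. -/
def f (ξ : ℂ) : ℂ := ξ ^ 8 * (ξ - (a : ℂ)) ^ 3 * (ξ - (b : ℂ)) ^ 9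

/-- The affine curve `S = {η¹⁰ = f ξ}`; a point `p` has coordinates `ξ = p.1`, `η = p.2`. -/
def S : Set (ℂ × ℂ) := {p | p.2 ^ 10 = f p.1}

/-- `S_reg = S ∖ {(0,0), (a,0), (b,0)}`. -/
def Sreg : Set (ℂ × ℂ) := S \ {(0, 0), ((a : ℂ), 0), ((b : ℂ), 0)}

/-- The tangent bundle of `S_reg`, as the set of pairs `(p, v)` with `p ∈ S_reg` and `v` in the
kernel of the differential of `η¹⁰ - f ξ` at `p`. -/
def TSreg : Set ((ℂ × ℂ) × (ℂ × ℂ)) :=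
  {x | x.1 ∈ Sreg ∧ 10 * x.1.2 ^ 9 * x.2.2 = deriv f x.1.1 * x.2.1}

/-! ### The Schwarz-Christoffel map and the developing map -/

/-- The closed upper half plane. -/
def upper : Set ℂ := {ξ | 0 ≤ ξ.im}

/-- The branch of `η = f^{1/10}` on the closed upper half plane, continuous there and positive on
the interval `(0, a)`: `e^{4πi/5} ξ^{1-2/10} (ξ-a)^{1-7/10} (ξ-b)^{1-1/10}`. -/
def etaBranch (ξ : ℂ) : ℂ :=
  Complex.exp ((4 * π / 5 : ℝ) * Complex.I) * ξ ^ ((4 / 5 : ℝ) : ℂ) *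
    (ξ - (a : ℂ)) ^ ((3 / 10 : ℝ) : ℂ) * (ξ - (b : ℂ)) ^ ((9 / 10 : ℝ) : ℂ)

/-- The integral of `dξ / η` along the straight path from `0` to `ξ`. -/
def calF (ξ : ℂ) : ℂ := ∫ t in (0 : ℝ)..1, ξ / etaBranch ((t : ℂ) * ξ)

/-- The positive constant `k = a / ∫₀ᵃ dξ / η`. -/
def k : ℝ := a / (calF (a : ℂ)).re

/-- The Schwarz-Christoffel map `F_T ξ = k ∫₀^ξ dξ / η` (meaningful on the closed upper half
plane). -/
def FT (ξ : ℂ) : ℂ := (k : ℂ) * calF ξ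

/-- The part of `S_reg` that lies over the closed upper half plane, on which `F_T ∘ π` is
meaningful. -/
def SregUpper : Set (ℂ × ℂ) := {p | p ∈ Sreg ∧ p.1 ∈ upper}

/-- The map `δ = F_T ∘ π`, with `π (ξ, η) = ξ`. -/
def delta (p : ℂ × ℂ) : ℂ := FT p.1

/-- A holomorphic function `D` on an open set `V` of the `ξ`-plane is a local determination of the
Schwarz-Christoffel integral `∫ k dξ / η`, that is, `dD = k dξ / η` for some tenth root `η` of
`f ξ`. -/
structure IsDetermination (V : Set ℂ) (D : ℂ → ℂ) : Prop where
  isOpen : IsOpen V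
  differentiableOn : DifferentiableOn ℂ D V
  deriv_pow : ∀ ξ ∈ V, deriv D ξ ^ 10 * f ξ = (k : ℂ) ^ 10

/-! ### The metric and its geodesics -/

/-- The Riemannian metric `Γ = (k/η) dξ ⊙ conj ((k/η) dξ)` on `S_reg`, at the point `p = (ξ, η)`,
evaluated on the tangent vectors `v` and `w`. -/
def Gam (p v w : ℂ × ℂ) : ℝ := ⟪(k : ℂ) / p.2 * v.1, (k : ℂ) / p.2 * w.1⟫_ℝ

/-- The density `k² |f ξ|^{-1/5}`. -/
def rho (ξ : ℂ) : ℝ := k ^ 2 * ‖f ξ‖ ^ (-(1 / 5 : ℝ))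

/-- `Γ` in the local coordinate `ξ` of `S_reg` is `k² |f ξ|^{-1/5} |dξ|²`. -/
theorem Gam_eq (p v w : ℂ × ℂ) (hp : p ∈ Sreg) :
    Gam p v w = rho p.1 * ⟪v.1, w.1⟫_ℝ := by
  have h : ‖p.2‖ ^ 10 = ‖f p.1‖ := by
    rw [← norm_pow]
    exact congrArg norm hp.1
  have hr : ‖f p.1‖ ^ (-(1 / 5 : ℝ)) = (‖p.2‖ ^ 2)⁻¹ := by
    rw [← h, Real.rpow_neg (by positivity), ← Real.rpow_natCast ‖p.2‖ 10,
      ← Real.rpow_mul (norm_nonneg _), ← Real.rpow_natCast ‖p.2‖ 2]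
    norm_num
  have hin : ∀ m x y : ℂ, ⟪m * x, m * y⟫_ℝ = ‖m‖ ^ 2 * ⟪x, y⟫_ℝ := by
    intro m x y
    rw [← Complex.normSq_eq_norm_sq]
    simp only [Complex.inner, Complex.normSq_apply, Complex.mul_re, Complex.mul_im,
      Complex.conj_re, Complex.conj_im]
    ring
  rw [Gam, hin, rho, hr, norm_div, div_pow, Complex.norm_real, Real.norm_eq_abs, sq_abs,
    div_eq_mul_inv]

/-- The acceleration at position `x` and velocity `v` of a geodesic of the metric
`r |dξ|²` on an open subset of `ℂ`. -/
def geodesicAcc (r : ℂ → ℝ) (x v : ℂ) : ℂ :=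
  (r x)⁻¹ • ((1 / 2 * ‖v‖ ^ 2) • ∇ r x - (fderiv ℝ r x v) • v)

/-- The acceleration is the one of the Euler-Lagrange (Levi-Civita) equation
`g(A, w) + (D_v g)(v, w) = ½ (D_w g)(v, v)` for the metric `g = r |dξ|²`. -/
theorem geodesicAcc_spec (r : ℂ → ℝ) (x v w : ℂ) (hr : r x ≠ 0) :
    r x * ⟪geodesicAcc r x v, w⟫_ℝ + fderiv ℝ r x v * ⟪v, w⟫_ℝ
      = 1 / 2 * (fderiv ℝ r x w * ⟪v, v⟫_ℝ) := by
  rw [geodesicAcc, real_inner_smul_left, inner_sub_left, real_inner_smul_left,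
    real_inner_smul_left, inner_gradient_left, real_inner_self_eq_norm_sq]
  field_simp
  ring

/-- The slope `dη / dξ = f' ξ / (10 η⁹)` of `S_reg` at `(ξ, η)`. -/
def slope (p : ℂ × ℂ) : ℂ := deriv f p.1 / (10 * p.2 ^ 9)

/-- The geodesic vector field of `(S_reg, Γ)` on the tangent bundle of `S_reg`: at `(p, v)` it is
`(v, A)`, where the `ξ`-component of `A` is the geodesic acceleration in the local coordinate `ξ`,
and the `η`-component of `A` is the derivative of `dη = slope · dξ` along the motion. -/
def geodesicField (x : (ℂ × ℂ) × (ℂ × ℂ)) : (ℂ × ℂ) × (ℂ × ℂ) :=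
  (x.2, (geodesicAcc rho x.1.1 x.2.1,
    fderiv ℂ slope x.1 x.2 * x.2.1 + slope x.1 * geodesicAcc rho x.1.1 x.2.1))

/-- `x` is an integral curve, defined on the set `J` of times, of the vector field `Z` on `M`. -/
def IsIntegralCurveIn {E : Type*} [NormedAddCommGroup E] [NormedSpace ℝ E]
    (Z : E → E) (M : Set E) (x : ℝ → E) (J : Set ℝ) : Prop :=
  IsIntegralCurveOn x (fun _ => Z) J ∧ ∀ t ∈ J, x t ∈ M

/-- `x` is the maximal integral curve through `x 0`, with domain the open interval `J`: any
integral curve `y` with the same initial value, on an open interval `J'` around `0`, is a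
restriction of `x`. -/
structure IsMaximalIntegralCurve {E : Type*} [NormedAddCommGroup E] [NormedSpace ℝ E]
    (Z : E → E) (M : Set E) (x : ℝ → E) (J : Set ℝ) : Prop where
  isOpen : IsOpen J
  ordConnected : J.OrdConnected
  zero_mem : (0 : ℝ) ∈ J
  integralCurve : IsIntegralCurveIn Z M x J
  maximal : ∀ (y : ℝ → E) (J' : Set ℝ), IsOpen J' → J'.OrdConnected → (0 : ℝ) ∈ J' →
    IsIntegralCurveIn Z M y J' → y 0 = x 0 → J' ⊆ J ∧ EqOn y x J'

/-- The vector field `Z` on `M` is incomplete: some maximal integral curve is not defined for all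
times. -/
def IsIncomplete {E : Type*} [NormedAddCommGroup E] [NormedSpace ℝ E]
    (Z : E → E) (M : Set E) : Prop :=
  ∃ (x : ℝ → E) (J : Set ℝ), IsMaximalIntegralCurve Z M x J ∧ J ≠ univ

/-- The curve `c`, on the open set `J` of times, is a geodesic of `(S_reg, Γ)`: its velocity curve
is an integral curve of the geodesic vector field. -/
def IsGeodesicOn (c : ℝ → ℂ × ℂ) (J : Set ℝ) : Prop :=
  IsIntegralCurveIn geodesicField TSreg (fun t => (c t, deriv c t)) J

/-- On `J`, the curve `z` in the plane is a straight segment, traversed uniformly. -/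
def IsStraightOn (z : ℝ → ℂ) (J : Set ℝ) : Prop :=
  ∃ z₀ α : ℂ, ∀ t ∈ J, z t = z₀ + (t : ℂ) * α

end Icosa

end

noncomputable section

namespace Icosa

/-! ### The geodesic equation in terms of a determination -/

/-! In the coordinate `ξ` the metric is conformal with density `ρ = k² |f|^{-1/5}`. Since `log ρ`
is, up to a constant, the real part of `-(1/5) log f`, the geodesic equation is holomorphic: `ξ'' =
f'/(10 f) · ξ'²` (`geodesicAcc_rho`). A determination satisfies `(D')¹⁰ f = k¹⁰`, hence `D''/D' =
-f'/(10 f)`, and the equation says exactly that `(D ∘ ξ)'' = 0`. The other coordinate carries no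
extra freedom: `D'(ξ) η` is a tenth root of `k¹⁰`, hence constant along a curve. This gives the
correspondence between geodesics and segments (`IsDetermination.isGeodesicOn_iff`).

The global statement is a Schwarz-Christoffel argument. The integrand `1/η` extends to a plane slit
downwards from `0`, `a`, `b` and decays like `|ξ|⁻²`, so integrating along vertical rays from
infinity yields a primitive that is continuous up to the real axis and has a limit at infinity. On
each real interval the argument of `1/η` is constant, so the boundary is developed onto segments in
known directions; closing the polygon forces the vertices `O`, `A`, `B`, with `P = F_T(∞)` inside
`OB` (`develop_b_and_ptP`). The open half plane then fills the open triangle, by openness of the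
map, compactness and a supporting functional, and connectedness of the triangle
(`develop_image_halfPlane`).

For incompleteness, the geodesic developed onto the open edge `OA` with unit speed exists only for
time `a`: an extension would have to reach a regular point over `[0, a]` whose developed value is a
vertex. -/

theorem differentiable_f : Differentiable ℂ f := by
  unfold f
  fun_prop

theorem f_eq_zero_iff {ξ : ℂ} : f ξ = 0 ↔ ξ = 0 ∨ ξ = (a : ℂ) ∨ ξ = (b : ℂ) := by
  simp [f, sub_eq_zero, or_assoc]

theorem f_ne_zero_of_mem_Sreg {p : ℂ × ℂ} (hp : p ∈ Sreg) : f p.1 ≠ 0 := by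
  intro h
  have h2 : p.2 = 0 := by
    have : p.2 ^ 10 = f p.1 := hp.1
    rw [h] at this
    exact pow_eq_zero_iff (by norm_num) |>.1 this
  apply hp.2
  obtain ⟨x, y⟩ := p
  simp only at h2
  subst h2
  simpa [f_eq_zero_iff] using h

theorem snd_ne_zero_of_mem_Sreg {p : ℂ × ℂ} (hp : p ∈ Sreg) : p.2 ≠ 0 := by
  intro h
  apply f_ne_zero_of_mem_Sreg hp
  have : p.2 ^ 10 = f p.1 := hp.1
  rw [← this, h]
  simp

theorem mem_Sreg_of_f_ne_zero {p : ℂ × ℂ} (hp : p.2 ^ 10 = f p.1) (h : f p.1 ≠ 0) : p ∈ Sreg := by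
  refine ⟨hp, ?_⟩
  rintro (rfl | rfl | rfl) <;> exact h (by simp [f_eq_zero_iff])

/-- Writing the density as `k² (|f|²)^{-1/10}` makes it a power of a smooth function; the formula is
the logarithmic derivative of `|f|^{-1/5}`. -/
theorem hasFDerivAt_rho {x : ℂ} (hx : f x ≠ 0) :
    ∃ L : ℂ →L[ℝ] ℝ, HasFDerivAt rho L x ∧
      ∀ v, L v = rho x * (-(1 / 5)) * (deriv f x / f x * v).re := by
  have hf : HasFDerivAt f ((fderiv ℂ f x).restrictScalars ℝ) x :=
    (differentiable_f x).hasFDerivAt.restrictScalars ℝ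
  have hpos : 0 < ‖f x‖ := norm_pos_iff.2 hx
  have h1 := ((hf.norm_sq).rpow_const (p := -(1 / 10 : ℝ)) (Or.inl (by positivity))).const_mul
    (k ^ 2)
  have e : ∀ z, k ^ 2 * (‖f z‖ ^ 2) ^ (-(1 / 10 : ℝ)) = rho z := by
    intro z
    rw [rho, ← Real.rpow_natCast ‖f z‖ 2, ← Real.rpow_mul (norm_nonneg _)]
    norm_num
  simp only [e] at h1
  refine ⟨_, h1, fun v => ?_⟩
  have e2 : (‖f x‖ ^ 2) ^ (-(1 / 10 : ℝ) - 1) = (‖f x‖ ^ 2) ^ (-(1 / 10 : ℝ)) / ‖f x‖ ^ 2 := by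
    rw [Real.rpow_sub_one (by positivity)]
  have e3 : (deriv f x / f x * v).re = ⟪f x, deriv f x * v⟫_ℝ / ‖f x‖ ^ 2 := by
    rw [Complex.inner, ← Complex.normSq_eq_norm_sq, div_mul_eq_mul_div, Complex.div_re]
    simp only [Complex.mul_re, Complex.conj_re, Complex.conj_im]
    ring
  have e4 : fderiv ℂ f x v = deriv f x * v := by
    rw [(differentiable_f x).hasDerivAt.hasFDerivAt.fderiv]
    simp [mul_comm]
  rw [← e x, e3]
  simp only [smul_apply, ContinuousLinearMap.comp_apply, smul_eq_mul, e2,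
    innerSL_apply_apply, ContinuousLinearMap.coe_restrictScalars', e4, nsmul_eq_mul]
  push_cast
  field_simp
  ring

theorem rho_pos (hk : k ≠ 0) {x : ℂ} (hx : f x ≠ 0) : 0 < rho x := by
  have : 0 < ‖f x‖ := norm_pos_iff.2 hx
  unfold rho
  positivity

/-- With `u = f'/f`, the gradient of `ρ` is `-(ρ/5) ū` and its derivative along `v` is `-(ρ/5) Re(u
v)`. The identity `2 Re(u v) v = u v² + ū |v|²` cancels the antiholomorphic terms. -/
theorem geodesicAcc_rho (hk : k ≠ 0) {x : ℂ} (hx : f x ≠ 0) (v : ℂ) :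
    geodesicAcc rho x v = deriv f x / (10 * f x) * v ^ 2 := by
  obtain ⟨L, hL, hLv⟩ := hasFDerivAt_rho hx
  have hr := (rho_pos hk hx).ne'
  -- The two components of the gradient come from pairing it with `1` and with `i`.
  have g1 : (∇ rho x).re = rho x * (-(1 / 5)) * (deriv f x / f x).re := by
    have := inner_gradient_left (𝕜 := ℝ) (f := rho) (x := x) (y := (1 : ℂ))
    rw [hL.fderiv, hLv, Complex.inner] at this
    simpa using this
  have g2 : (∇ rho x).im = rho x * (1 / 5) * (deriv f x / f x).im := by
    have := inner_gradient_left (𝕜 := ℝ) (f := rho) (x := x) (y := Complex.I)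
    rw [hL.fderiv, hLv, Complex.inner] at this
    simpa using this
  have e : deriv f x / (10 * f x) = (1 / 10 : ℝ) • (deriv f x / f x) := by
    rw [Complex.real_smul]
    push_cast
    field_simp
  rw [geodesicAcc, hL.fderiv, hLv, e, ← Complex.normSq_eq_norm_sq, Complex.normSq_apply]
  generalize deriv f x / f x = u at *
  apply Complex.ext
  · simp only [Complex.smul_re, Complex.smul_im, smul_eq_mul, Complex.sub_re, g1, Complex.mul_re,
      pow_two, Complex.mul_im]
    field_simp
    ring
  · simp only [Complex.smul_re, Complex.smul_im, smul_eq_mul, Complex.sub_im, g2, Complex.mul_re,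
      pow_two, Complex.mul_im]
    field_simp
    ring

namespace IsDetermination

variable {V : Set ℂ} {D : ℂ → ℂ}

theorem f_ne_zero (hD : IsDetermination V D) (hk : k ≠ 0) {z : ℂ} (hz : z ∈ V) : f z ≠ 0 := by
  intro h
  have := hD.deriv_pow z hz
  rw [h, mul_zero] at this
  exact hk (by simpa using this.symm)

theorem deriv_ne_zero (hD : IsDetermination V D) (hk : k ≠ 0) {z : ℂ} (hz : z ∈ V) :
    deriv D z ≠ 0 := by
  intro h
  have := hD.deriv_pow z hz
  rw [h] at this
  exact hk (by simpa using this.symm)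

theorem hasStrictDerivAt (hD : IsDetermination V D) {z : ℂ} (hz : z ∈ V) :
    HasStrictDerivAt D (deriv D z) z := by
  have h : AnalyticAt ℂ D z := hD.differentiableOn.analyticAt (hD.isOpen.mem_nhds hz)
  exact h.hasStrictDerivAt

/-- Differentiate `(D')¹⁰ f = k¹⁰` and cancel `(D')⁹`. -/
theorem hasDerivAt_deriv (hD : IsDetermination V D) (hk : k ≠ 0) {z : ℂ} (hz : z ∈ V) :
    HasDerivAt (deriv D) (-(deriv f z / (10 * f z)) * deriv D z) z := by
  have h : AnalyticAt ℂ D z := hD.differentiableOn.analyticAt (hD.isOpen.mem_nhds hz)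
  have h1 : HasDerivAt (deriv D) (deriv (deriv D) z) z := h.deriv.differentiableAt.hasDerivAt
  have h2 := (h1.pow 10).mul (differentiable_f z).hasDerivAt
  have h3 : HasDerivAt (fun _ : ℂ => (k : ℂ) ^ 10) 0 z := hasDerivAt_const _ _
  have h4 := h3.congr_of_eventuallyEq
    (f₁ := (fun y => (deriv D y) ^ 10 * f y)) (by
      filter_upwards [hD.isOpen.mem_nhds hz] with y hy using hD.deriv_pow y hy)
  have h5 := h2.unique h4
  have hf := hD.f_ne_zero hk hz
  have hd := hD.deriv_ne_zero hk hz
  convert h1 using 1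
  push_cast at h5
  simp only [Pi.pow_apply] at h5
  have h6 : deriv D z ^ 9 * (10 * deriv (deriv D) z * f z + deriv D z * deriv f z) = 0 := by
    rw [← h5]; ring
  have h7 := (mul_eq_zero.1 h6).resolve_left (pow_ne_zero _ hd)
  field_simp
  linear_combination -h7

end IsDetermination

theorem differentiableAt_slope {p : ℂ × ℂ} (hp : p.2 ≠ 0) : DifferentiableAt ℂ slope p := by
  have h : Differentiable ℂ (deriv f) := by
    have : ContDiff ℂ 2 f := by unfold f; fun_prop
    exact this.differentiable_deriv_two
  have h1 : DifferentiableAt ℂ (fun q : ℂ × ℂ => deriv f q.1) p :=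
    (h p.1).comp p differentiableAt_fst
  have h2 : DifferentiableAt ℂ (fun q : ℂ × ℂ => 10 * q.2 ^ 9) p := by fun_prop
  refine (h1.mul (h2.inv (mul_ne_zero (by norm_num) (pow_ne_zero _ hp)))).congr_of_eventuallyEq
    (Eventually.of_forall fun q => ?_)
  simp only [slope, div_eq_mul_inv, Pi.mul_apply, Pi.inv_apply]

theorem slope_eq {p : ℂ × ℂ} (hp : p ∈ Sreg) : slope p = deriv f p.1 / (10 * f p.1) * p.2 := by
  have h : p.2 ^ 10 = f p.1 := hp.1
  have := snd_ne_zero_of_mem_Sreg hp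
  rw [slope, ← h]
  field_simp

/-- A criterion for geodesics in terms of first derivatives. -/
theorem isGeodesicOn_of_hasDerivAt {c : ℝ → ℂ × ℂ} {J : Set ℝ} {v : ℝ → ℂ}
    (hk : k ≠ 0) (hJ : IsOpen J) (hS : ∀ t ∈ J, c t ∈ Sreg)
    (hc : ∀ t ∈ J, HasDerivAt c (v t, slope (c t) * v t) t)
    (hv : ∀ t ∈ J, HasDerivAt v (deriv f (c t).1 / (10 * f (c t).1) * v t ^ 2) t) :
    IsGeodesicOn c J := by
  refine ⟨fun t ht => ?_, fun t ht => ⟨hS t ht, ?_⟩⟩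
  · have hp := hS t ht
    have e : deriv c =ᶠ[𝓝 t] fun s => (v s, slope (c s) * v s) := by
      filter_upwards [hJ.mem_nhds ht] with s hs using (hc s hs).deriv
    have hsl : HasDerivAt (fun s => slope (c s))
        (fderiv ℂ slope (c t) (v t, slope (c t) * v t)) t :=
      ((differentiableAt_slope (snd_ne_zero_of_mem_Sreg hp)).hasFDerivAt.restrictScalars
        ℝ).comp_hasDerivAt t (hc t ht)
    -- The product rule for `slope (c s) * v s` is precisely the `η`-component of the geodesic
    -- field.
    have h2 := ((hv t ht).prodMk (hsl.mul (hv t ht))).congr_of_eventuallyEq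
      (f₁ := deriv c) e
    have := (hc t ht).prodMk h2
    refine (this.congr_deriv ?_).hasDerivWithinAt
    simp only [geodesicField, (hc t ht).deriv, geodesicAcc_rho hk (f_ne_zero_of_mem_Sreg hp)]
  · have hp := snd_ne_zero_of_mem_Sreg (hS t ht)
    simp only [(hc t ht).deriv, slope]
    field_simp

theorem IsGeodesicOn.hasDerivAt {c : ℝ → ℂ × ℂ} {J : Set ℝ} (hJ : IsOpen J)
    (h : IsGeodesicOn c J) {t : ℝ} (ht : t ∈ J) : HasDerivAt c (deriv c t) t := by
  have := ((h.1 t ht).hasDerivAt (hJ.mem_nhds ht)).hasFDerivAt.fst.hasDerivAt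
  simpa [geodesicField] using this

theorem IsGeodesicOn.hasDerivAt_velocity {c : ℝ → ℂ × ℂ} {J : Set ℝ} (hk : k ≠ 0) (hJ : IsOpen J)
    (h : IsGeodesicOn c J) {t : ℝ} (ht : t ∈ J) :
    HasDerivAt (fun s => (deriv c s).1)
      (deriv f (c t).1 / (10 * f (c t).1) * (deriv c t).1 ^ 2) t := by
  have := ((h.1 t ht).hasDerivAt (hJ.mem_nhds ht)).hasFDerivAt.snd.fst.hasDerivAt
  rw [← geodesicAcc_rho hk (f_ne_zero_of_mem_Sreg (h.2 t ht).1)]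
  simpa [geodesicField] using this

theorem exists_const_of_hasDerivAt_zero {g : ℝ → ℂ} {J : Set ℝ} (hJ : IsOpen J)
    (hc : J.OrdConnected) (h : ∀ t ∈ J, HasDerivAt g 0 t) : ∃ z, ∀ t ∈ J, g t = z := by
  rcases J.eq_empty_or_nonempty with rfl | ⟨t₀, h₀⟩
  · exact ⟨0, by simp⟩
  · refine ⟨g t₀, fun t ht => ?_⟩
    refine hJ.eqOn_of_deriv_eq (f := g) (g := fun _ => g t₀) hc.isPreconnected
      (fun s hs => (h s hs).differentiableAt.differentiableWithinAt)
      (differentiableOn_const _) (fun s hs => ?_) h₀ rfl ht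
    simp [(h s hs).deriv]

namespace IsDetermination

variable {V : Set ℂ} {D : ℂ → ℂ}

/-- The second derivative of `D ∘ ξ` is `D'' ξ'² + D' ξ''`, and the two terms cancel by
`hasDerivAt_deriv` and the geodesic equation. -/
theorem isStraightOn (hD : IsDetermination V D) (hk : k ≠ 0) {c : ℝ → ℂ × ℂ} {J : Set ℝ}
    (hJ : IsOpen J) (hJc : J.OrdConnected) (hV : ∀ t ∈ J, (c t).1 ∈ V) (hc : IsGeodesicOn c J) :
    IsStraightOn (fun t => D (c t).1) J := by
  have hξ : ∀ t ∈ J, HasDerivAt (fun s => (c s).1) (deriv c t).1 t := fun t ht =>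
    (hc.hasDerivAt hJ ht).hasFDerivAt.fst.hasDerivAt.congr_deriv (by simp)
  have h1 : ∀ t ∈ J, HasDerivAt (fun s => D (c s).1) (deriv D (c t).1 * (deriv c t).1) t :=
    fun t ht => ((hD.hasStrictDerivAt (hV t ht)).hasDerivAt.comp_of_eq t (hξ t ht) rfl)
  have h2 : ∀ t ∈ J, HasDerivAt (fun s => deriv D (c s).1 * (deriv c s).1) 0 t := by
    intro t ht
    have := ((hD.hasDerivAt_deriv hk (hV t ht)).comp_of_eq t (hξ t ht) rfl).mul
      (hc.hasDerivAt_velocity hk hJ ht)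
    refine this.congr_deriv ?_
    simp only [Function.comp]
    ring
  obtain ⟨α, hα⟩ := exists_const_of_hasDerivAt_zero hJ hJc h2
  have h3 : ∀ t ∈ J, HasDerivAt (fun s : ℝ => D (c s).1 - (s : ℂ) * α) 0 t := by
    intro t ht
    refine ((h1 t ht).sub ((Complex.ofRealCLM.hasDerivAt (x := t)).mul_const α)).congr_deriv ?_
    simp [hα t ht]
  obtain ⟨z, hz⟩ := exists_const_of_hasDerivAt_zero hJ hJc h3
  exact ⟨z, α, fun t ht => by rw [← hz t ht]; ring⟩

/-- The fibre coordinate `η` along a curve is `w / D'(ξ)` with a constant `w`. -/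
theorem exists_deriv_mul_eq (hD : IsDetermination V D) {c : ℝ → ℂ × ℂ} {J : Set ℝ}
    (hJc : J.OrdConnected) (hcont : ContinuousOn c J)
    (hV : ∀ t ∈ J, c t ∈ Sreg ∧ (c t).1 ∈ V) :
    ∃ w, ∀ t ∈ J, deriv D (c t).1 * (c t).2 = w := by
  rcases J.eq_empty_or_nonempty with rfl | ⟨t₀, h₀⟩
  · exact ⟨0, by simp⟩
  -- The product takes values in the finite, hence discrete, set of tenth roots of `k¹⁰`, and a
  -- continuous map from an interval to a discrete set is constant.
  · let R : Set ℂ := {w | w ^ 10 = (k : ℂ) ^ 10}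
    have hR : R.Finite := by
      refine ((Polynomial.nthRootsFinset 10 ((k : ℂ) ^ 10)).finite_toSet).subset ?_
      intro w hw
      simpa [R, Polynomial.mem_nthRootsFinset] using hw
    have hd : ContinuousOn (deriv D) V :=
      (hD.differentiableOn.deriv hD.isOpen).continuousOn
    refine ⟨deriv D (c t₀).1 * (c t₀).2, fun t ht => ?_⟩
    refine hJc.isPreconnected.constant_of_mapsTo hR.isDiscrete
      (f := fun t => deriv D (c t).1 * (c t).2) ?_ ?_ ht h₀
    · exact (hd.comp (continuous_fst.comp_continuousOn hcont) fun t ht => (hV t ht).2).mul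
        (continuous_snd.comp_continuousOn hcont)
    · intro t ht
      have h : (c t).2 ^ 10 = f (c t).1 := (hV t ht).1.1
      change (deriv D (c t).1 * (c t).2) ^ 10 = (k : ℂ) ^ 10
      rw [mul_pow, h, hD.deriv_pow _ (hV t ht).2]

/-- The curve is only assumed continuous. Differentiability of `ξ` comes from the local inverse of
`D` applied to the line, and that of `η` from `η = w / D'(ξ)`. -/
theorem isGeodesicOn (hD : IsDetermination V D) (hk : k ≠ 0) {c : ℝ → ℂ × ℂ} {J : Set ℝ}
    (hJ : IsOpen J) (hJc : J.OrdConnected) (hcont : ContinuousOn c J)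
    (hV : ∀ t ∈ J, c t ∈ Sreg ∧ (c t).1 ∈ V) (hs : IsStraightOn (fun t => D (c t).1) J) :
    IsGeodesicOn c J := by
  obtain ⟨z₀, α, hα⟩ := hs
  obtain ⟨w, hw⟩ := hD.exists_deriv_mul_eq hJc hcont hV
  have hne : ∀ t ∈ J, deriv D (c t).1 ≠ 0 := fun t ht => hD.deriv_ne_zero hk (hV t ht).2
  have hξ : ∀ t ∈ J, HasDerivAt (fun s => (c s).1) (α / deriv D (c t).1) t := by
    intro t ht
    have hst := hD.hasStrictDerivAt (hV t ht).2
    have hl := hst.to_localInverse (hne t ht)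
    have hinv := (hst.hasStrictFDerivAt_equiv (hne t ht)).eventually_left_inverse
    have hct : Tendsto (fun s => (c s).1) (𝓝 t) (𝓝 (c t).1) :=
      (continuous_fst.comp_continuousOn hcont).continuousAt (hJ.mem_nhds ht)
    have hlin : HasDerivAt (fun s : ℝ => z₀ + (s : ℂ) * α) α t := by
      refine (((Complex.ofRealCLM.hasDerivAt (x := t)).mul_const α).const_add z₀).congr_deriv ?_
      simp
    have hcomp := hl.hasDerivAt.comp_of_eq t hlin (show z₀ + (t : ℂ) * α = D (c t).1 from (hα t ht).symm).symm
    refine (hcomp.congr_of_eventuallyEq ?_).congr_deriv (by rw [div_eq_mul_inv, mul_comm])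
    filter_upwards [hct.eventually hinv, hJ.mem_nhds ht] with s hs hsJ
    simp only [Function.comp]
    rw [← hα s hsJ]
    exact hs.symm
  have hder : ∀ t ∈ J, HasDerivAt (fun s => deriv D (c s).1)
      (-(deriv f (c t).1 / (10 * f (c t).1)) * α) t := by
    intro t ht
    refine ((hD.hasDerivAt_deriv hk (hV t ht).2).comp_of_eq t (hξ t ht) rfl).congr_deriv ?_
    have := hne t ht
    field_simp
  refine isGeodesicOn_of_hasDerivAt (v := fun t => α / deriv D (c t).1) hk hJ
    (fun t ht => (hV t ht).1) (fun t ht => ?_) (fun t ht => ?_)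
  · refine (hξ t ht).prodMk ?_
    have h1 : HasDerivAt (fun s => w / deriv D (c s).1)
        (slope (c t) * (α / deriv D (c t).1)) t := by
      refine ((hasDerivAt_const t w).div (hder t ht) (hne t ht)).congr_deriv ?_
      rw [slope_eq (hV t ht).1, ← hw t ht]
      have := hne t ht
      field_simp
      ring
    refine h1.congr_of_eventuallyEq ?_
    filter_upwards [hJ.mem_nhds ht] with s hs
    rw [← hw s hs, mul_div_cancel_left₀ _ (hne s hs)]
  · refine ((hasDerivAt_const t α).div (hder t ht) (hne t ht)).congr_deriv ?_
    have := hne t ht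
    field_simp
    ring

theorem isGeodesicOn_iff (hD : IsDetermination V D) (hk : k ≠ 0) {c : ℝ → ℂ × ℂ} {J : Set ℝ}
    (hJ : IsOpen J) (hJc : J.OrdConnected) (hcont : ContinuousOn c J)
    (hV : ∀ t ∈ J, c t ∈ Sreg ∧ (c t).1 ∈ V) :
    IsGeodesicOn c J ↔ IsStraightOn (fun t => D (c t).1) J :=
  ⟨hD.isStraightOn hk hJ hJc fun t ht => (hV t ht).2, hD.isGeodesicOn hk hJ hJc hcont hV⟩

theorem exists_isGeodesicOn (hD : IsDetermination V D) (hk : k ≠ 0) {p : ℂ × ℂ} (hp : p ∈ Sreg)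
    (hpV : p.1 ∈ V) (α : ℂ) :
    ∃ (ε : ℝ) (c : ℝ → ℂ × ℂ), 0 < ε ∧ c 0 = p ∧ IsGeodesicOn c (Ioo (-ε) ε) ∧
      ∀ t ∈ Ioo (-ε) ε, (c t).1 ∈ V ∧ D (c t).1 = D p.1 + (t : ℂ) * α := by
  have hst := hD.hasStrictDerivAt hpV
  have hne := hD.deriv_ne_zero hk hpV
  have he := hst.hasStrictFDerivAt_equiv hne
  set g := hst.localInverse D (deriv D p.1) p.1 hne with hg
  have hg0 : g (D p.1) = p.1 := he.localInverse_apply_image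
  have hgr : ∀ᶠ y in 𝓝 (D p.1), D (g y) = y := he.eventually_right_inverse
  have hgd : ∀ᶠ y in 𝓝 (D p.1), ContinuousAt g y := by
    filter_upwards [(he.toOpenPartialHomeomorph D).open_target.mem_nhds
      he.image_mem_toOpenPartialHomeomorph_target] with y hy
    exact (he.toOpenPartialHomeomorph D).continuousAt_symm hy
  have hgV : ∀ᶠ y in 𝓝 (D p.1), g y ∈ V := by
    have : ContinuousAt g (D p.1) := hgd.self_of_nhds
    exact this.eventually (by rw [hg0]; exact hD.isOpen.mem_nhds hpV)
  have hlin : Continuous fun t : ℝ => D p.1 + (t : ℂ) * α := by fun_prop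
  have hlin0 : Tendsto (fun t : ℝ => D p.1 + (t : ℂ) * α) (𝓝 0) (𝓝 (D p.1)) := by
    simpa using hlin.tendsto 0
  have hev := hlin0.eventually (hgr.and (hgd.and hgV))
  obtain ⟨ε, hε, hball⟩ := Metric.eventually_nhds_iff_ball.1 hev
  rw [Real.ball_eq_Ioo, zero_sub, zero_add] at hball
  -- This constant is forced by `c 0 = p`; since `w¹⁰ = k¹⁰`, the lifted curve stays on `S`.
  let w := deriv D p.1 * p.2
  let ξ : ℝ → ℂ := fun t => g (D p.1 + (t : ℂ) * α)
  let c : ℝ → ℂ × ℂ := fun t => (ξ t, w / deriv D (ξ t))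
  have hVt : ∀ t ∈ Ioo (-ε) ε, ξ t ∈ V := fun t ht => (hball t ht).2.2
  have hDt : ∀ t ∈ Ioo (-ε) ε, D (ξ t) = D p.1 + (t : ℂ) * α := fun t ht => (hball t ht).1
  have hξc : ContinuousOn ξ (Ioo (-ε) ε) := fun t ht =>
    (ContinuousAt.comp (f := fun t : ℝ => D p.1 + (t : ℂ) * α) (hball t ht).2.1
      hlin.continuousAt).continuousWithinAt
  have hd : ContinuousOn (deriv D) V := (hD.differentiableOn.deriv hD.isOpen).continuousOn
  have hcc : ContinuousOn c (Ioo (-ε) ε) :=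
    hξc.prodMk (continuousOn_const.div (hd.comp hξc hVt) fun t ht => hD.deriv_ne_zero hk (hVt t ht))
  have hreg : ∀ t ∈ Ioo (-ε) ε, c t ∈ Sreg := by
    intro t ht
    refine mem_Sreg_of_f_ne_zero ?_ (hD.f_ne_zero hk (hVt t ht))
    have h1 := hD.deriv_pow _ (hVt t ht)
    have h2 := hD.deriv_pow _ hpV
    have h3 := hD.deriv_ne_zero hk (hVt t ht)
    have h4 : p.2 ^ 10 = f p.1 := hp.1
    simp only [c, w]
    rw [div_pow, mul_pow, h4, h2, ← h1]
    field_simp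
  refine ⟨ε, c, hε, ?_, ?_, fun t ht => ⟨hVt t ht, hDt t ht⟩⟩
  · simp only [c, ξ, w, Complex.ofReal_zero, zero_mul, add_zero, hg0]
    rw [mul_div_cancel_left₀ _ hne]
  · exact hD.isGeodesicOn hk isOpen_Ioo ordConnected_Ioo hcc (fun t ht => ⟨hreg t ht, hVt t ht⟩)
      ⟨D p.1, α, hDt⟩

end IsDetermination

/-! ### The Schwarz-Christoffel integrand on a slit plane -/

theorem b_eq : b = (1 + √5) / 2 := by
  rw [b, Real.cos_pi_div_five]
  ring

theorem a_eq : a = (√5 - 1) / 2 := by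
  have h : 2 * π / 5 = 2 * (π / 5) := by ring
  have h5 : √5 ^ 2 = 5 := Real.sq_sqrt (by norm_num)
  rw [a, h, Real.cos_two_mul, Real.cos_pi_div_five]
  linear_combination (1 / 4 : ℝ) * h5

theorem b_eq_add : b = a + 1 := by
  rw [a_eq, b_eq]
  ring

theorem half_le_a : 1 / 2 ≤ a := by
  have : (2 : ℝ) ≤ √5 := Real.le_sqrt_of_sq_le (by norm_num)
  rw [a_eq]
  linarith

theorem a_pos : 0 < a := by linarith [half_le_a]

theorem a_lt_b : a < b := by linarith [b_eq_add]

theorem b_pos : 0 < b := by linarith [b_eq_add, a_pos]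

/-- The plane slit downwards from the points `0`, `a`, `b`. -/
def slitDomain : Set ℂ := {z | 0 < z.im ∨ (z.re ≠ 0 ∧ z.re ≠ a ∧ z.re ≠ b)}

theorem isOpen_slitDomain : IsOpen slitDomain := by
  refine (isOpen_lt continuous_const Complex.continuous_im).union ?_
  exact (isOpen_ne_fun Complex.continuous_re continuous_const).inter
    ((isOpen_ne_fun Complex.continuous_re continuous_const).inter
      (isOpen_ne_fun Complex.continuous_re continuous_const))

theorem mem_slitDomain_of_mem_upper {z : ℂ} (hz : z ∈ upper) (hf : f z ≠ 0) :
    z ∈ slitDomain := by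
  rcases (show 0 ≤ z.im from hz).lt_or_eq with h | h
  · exact Or.inl h
  · refine Or.inr ⟨?_, ?_, ?_⟩ <;> intro h' <;> apply hf <;> rw [f_eq_zero_iff]
    · exact Or.inl (Complex.ext h' h.symm)
    · exact Or.inr (Or.inl (Complex.ext h' h.symm))
    · exact Or.inr (Or.inr (Complex.ext h' h.symm))

/-- Rotation by `-i` turns the principal cut into a downward ray, so each factor of `integrand` is
holomorphic across the real axis away from its own branch point. -/
theorem slitDomain_factor {z : ℂ} (hz : z ∈ slitDomain) :
    -Complex.I * z ∈ Complex.slitPlane ∧ -Complex.I * (z - (a : ℂ)) ∈ Complex.slitPlane ∧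
      -Complex.I * (z - (b : ℂ)) ∈ Complex.slitPlane := by
  simp only [Complex.mem_slitPlane_iff]
  rcases hz with h | ⟨h1, h2, h3⟩
  · simp [h]
  · simp [h1, sub_eq_zero, h2.symm, h3.symm]

theorem slitDomain_ne {z : ℂ} (hz : z ∈ slitDomain) :
    z ≠ 0 ∧ z - (a : ℂ) ≠ 0 ∧ z - (b : ℂ) ≠ 0 := by
  obtain ⟨h1, h2, h3⟩ := slitDomain_factor hz
  exact ⟨right_ne_zero_of_mul (Complex.slitPlane_ne_zero h1),
    right_ne_zero_of_mul (Complex.slitPlane_ne_zero h2),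
    right_ne_zero_of_mul (Complex.slitPlane_ne_zero h3)⟩

/-- The continuation of `1 / η` from the closed upper half plane to the slit plane. -/
def integrand (z : ℂ) : ℂ :=
  Complex.exp ((π / 5 : ℝ) * Complex.I) * (-Complex.I * z) ^ ((-(4 / 5) : ℝ) : ℂ) *
    (-Complex.I * (z - (a : ℂ))) ^ ((-(3 / 10) : ℝ) : ℂ) *
    (-Complex.I * (z - (b : ℂ))) ^ ((-(9 / 10) : ℝ) : ℂ)

theorem norm_integrand (z : ℂ) : ‖integrand z‖ =
    ‖z‖ ^ (-(4 / 5) : ℝ) * ‖z - (a : ℂ)‖ ^ (-(3 / 10) : ℝ) * ‖z - (b : ℂ)‖ ^ (-(9 / 10) : ℝ) := by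
  simp only [integrand, norm_mul, Complex.norm_exp_ofReal_mul_I, Complex.norm_cpow_real, norm_neg,
    Complex.norm_I, one_mul]

/-- The derivative of `integrand`. -/
def integrandDeriv (z : ℂ) : ℂ :=
  integrand z * (-(4 / 5) / z - (3 / 10) / (z - (a : ℂ)) - (9 / 10) / (z - (b : ℂ)))

theorem hasDerivAt_cpow_factor {p z : ℂ} (e : ℝ) (h : -Complex.I * (z - p) ∈ Complex.slitPlane) :
    HasDerivAt (fun z => (-Complex.I * (z - p)) ^ (e : ℂ))
      ((-Complex.I * (z - p)) ^ (e : ℂ) * (e / (z - p))) z := by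
  have h1 : HasDerivAt (fun z => -Complex.I * (z - p)) (-Complex.I) z := by
    simpa using ((hasDerivAt_id z).sub_const p).const_mul (-Complex.I)
  refine (h1.cpow_const h).congr_deriv ?_
  have h0 := Complex.slitPlane_ne_zero h
  have h2 : z - p ≠ 0 := right_ne_zero_of_mul h0
  rw [Complex.cpow_sub _ _ h0, Complex.cpow_one]
  field_simp

theorem hasDerivAt_integrand {z : ℂ} (hz : z ∈ slitDomain) :
    HasDerivAt integrand (integrandDeriv z) z := by
  obtain ⟨h1, h2, h3⟩ := slitDomain_factor hz
  obtain ⟨n1, n2, n3⟩ := slitDomain_ne hz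
  have d1 := hasDerivAt_cpow_factor (p := 0) (-(4 / 5)) (by simpa using h1)
  have d2 := hasDerivAt_cpow_factor (-(3 / 10)) h2
  have d3 := hasDerivAt_cpow_factor (-(9 / 10)) h3
  simp only [sub_zero] at d1
  refine (((d1.const_mul (Complex.exp ((π / 5 : ℝ) * Complex.I))).mul d2).mul d3).congr_deriv ?_
  simp only [integrandDeriv, integrand, Pi.mul_apply]
  push_cast
  ring

/-- For `w` in the closed upper half plane the argument lies in `[0, π]`, so subtracting `π/2` does
not cross the principal cut. -/
theorem neg_I_mul_cpow {w : ℂ} (hw : 0 ≤ w.im) {e : ℝ} (he : e ≠ 0) :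
    (-Complex.I * w) ^ ((-e : ℝ) : ℂ)
      = Complex.exp ((e * (π / 2) : ℝ) * Complex.I) * (w ^ (e : ℂ))⁻¹ := by
  rcases eq_or_ne w 0 with rfl | h0
  -- At `w = 0` both sides vanish by the conventions `0 ^ c = 0` for `c ≠ 0` and `0⁻¹ = 0`.
  · have h1 : ((-e : ℝ) : ℂ) ≠ 0 := by simpa using he
    have h2 : (e : ℂ) ≠ 0 := by simpa using he
    simp [Complex.zero_cpow h2, Complex.zero_cpow h1, -Complex.ofReal_neg]
  · have hlog : Complex.log (-Complex.I * w) = Complex.log w - (π / 2) * Complex.I := by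
      have h1 : 0 ≤ w.arg := Complex.arg_nonneg_iff.2 hw
      have h2 := Complex.arg_le_pi w
      rw [Complex.log_mul (by simp) h0 (by
        rw [Complex.arg_neg_I]
        constructor <;> linarith [Real.pi_pos]), Complex.log_neg_I]
      ring
    have hI : -Complex.I * w ≠ 0 := mul_ne_zero (by simp) h0
    rw [Complex.cpow_def_of_ne_zero hI, Complex.cpow_def_of_ne_zero h0, ← Complex.exp_neg,
      ← Complex.exp_add, hlog]
    congr 1
    push_cast
    ring

theorem integrand_eq_inv_etaBranch {z : ℂ} (hz : z ∈ upper) : integrand z = (etaBranch z)⁻¹ := by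
  have hz' : 0 ≤ z.im := hz
  have key : Complex.exp ((π / 5 : ℝ) * Complex.I) *
      Complex.exp ((4 / 5 * (π / 2) : ℝ) * Complex.I) *
      Complex.exp ((3 / 10 * (π / 2) : ℝ) * Complex.I) *
      Complex.exp ((9 / 10 * (π / 2) : ℝ) * Complex.I)
      = (Complex.exp ((4 * π / 5 : ℝ) * Complex.I))⁻¹ := by
    rw [← Complex.exp_add, ← Complex.exp_add, ← Complex.exp_add, ← Complex.exp_neg,
      Complex.exp_eq_exp_iff_exists_int]
    -- The phases add up to `π/5 + π = 6π/5`, which is `-4π/5` plus one full turn.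
    refine ⟨1, ?_⟩
    push_cast
    ring
  rw [integrand, etaBranch, neg_I_mul_cpow hz' (by norm_num),
    neg_I_mul_cpow (by simpa using hz') (by norm_num),
    neg_I_mul_cpow (by simpa using hz') (by norm_num), mul_inv, mul_inv, mul_inv, ← key]
  ring

theorem integrand_ne_zero {z : ℂ} (hz : z ∈ slitDomain) : integrand z ≠ 0 := by
  obtain ⟨h1, h2, h3⟩ := slitDomain_ne hz
  rw [← norm_ne_zero_iff, norm_integrand]
  have := norm_pos_iff.2 h1
  have := norm_pos_iff.2 h2
  have := norm_pos_iff.2 h3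
  positivity

theorem cpow_ofReal_pow_ten (w : ℂ) (e : ℝ) (n : ℕ) (h : 10 * e = n) :
    (w ^ ((-e : ℝ) : ℂ)) ^ 10 = (w ^ n)⁻¹ := by
  rw [← Complex.cpow_nat_mul]
  have : ((10 : ℕ) : ℂ) * ((-e : ℝ) : ℂ) = -(n : ℂ) := by
    rw [← Complex.ofReal_natCast n, ← h]
    push_cast
    ring
  rw [this, Complex.cpow_neg, Complex.cpow_natCast]

theorem integrand_pow_mul {z : ℂ} (hz : z ∈ slitDomain) : integrand z ^ 10 * f z = 1 := by
  obtain ⟨h1, h2, h3⟩ := slitDomain_ne hz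
  have e : Complex.exp ((π / 5 : ℝ) * Complex.I) ^ 10 = 1 := by
    rw [← Complex.exp_nat_mul, Complex.exp_eq_one_iff]
    refine ⟨1, ?_⟩
    push_cast
    ring
  have hI : (-Complex.I) ^ 20 = 1 := by
    rw [Even.neg_pow (by decide), show 20 = 4 * 5 by norm_num, pow_mul, Complex.I_pow_four,
      one_pow]
  rw [integrand, mul_pow, mul_pow, mul_pow, e, cpow_ofReal_pow_ten _ _ 8 (by norm_num),
    cpow_ofReal_pow_ten _ _ 3 (by norm_num), cpow_ofReal_pow_ten _ _ 9 (by norm_num), f,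
    mul_pow, mul_pow, mul_pow]
  have hI' : -Complex.I ≠ 0 := by simp
  field_simp
  linear_combination -hI

/-! ### Bounds for the integrand -/

/-- The exponents `-4/5`, `-3/10`, `-9/10` sum to `-2`; this quadratic decay makes the integral from
infinity converge. -/
theorem norm_integrand_le_of_le {z : ℂ} {x : ℝ} (hx : 0 < x) (h1 : x ≤ ‖z‖)
    (h2 : x ≤ ‖z - (a : ℂ)‖) (h3 : x ≤ ‖z - (b : ℂ)‖) : ‖integrand z‖ ≤ (x ^ 2)⁻¹ := by
  have e : (x ^ 2)⁻¹ = x ^ (-(4 / 5) : ℝ) * x ^ (-(3 / 10) : ℝ) * x ^ (-(9 / 10) : ℝ) := by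
    rw [← Real.rpow_add hx, ← Real.rpow_add hx, ← Real.rpow_natCast, ← Real.rpow_neg hx.le]
    norm_num
  rw [norm_integrand, e]
  have g1 := Real.rpow_le_rpow_of_nonpos hx h1 (z := -(4 / 5)) (by norm_num)
  have g2 := Real.rpow_le_rpow_of_nonpos hx h2 (z := -(3 / 10)) (by norm_num)
  have g3 := Real.rpow_le_rpow_of_nonpos hx h3 (z := -(9 / 10)) (by norm_num)
  gcongr

theorem rpow_neg_le_one_add {u e : ℝ} (hu : 0 ≤ u) (he : 0 < e) (he' : e ≤ 9 / 10) :
    u ^ (-e) ≤ 1 + u ^ (-(9 / 10) : ℝ) := by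
  have h0 : 0 ≤ u ^ (-(9 / 10) : ℝ) := Real.rpow_nonneg hu _
  rcases hu.eq_or_lt with rfl | hu
  · rw [Real.zero_rpow (by linarith)]
    linarith
  rcases le_total u 1 with h | h
  · have := Real.rpow_le_rpow_of_exponent_ge hu h (show -(9 / 10) ≤ -e by linarith)
    linarith
  · have := Real.rpow_le_one_of_one_le_of_nonpos h (show -e ≤ 0 by linarith)
    linarith

theorem rpow_neg_le_four {u e : ℝ} (hu : 1 / 4 ≤ u) (he : 0 < e) (he' : e ≤ 9 / 10) :
    u ^ (-e) ≤ 4 := by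
  have h1 := Real.rpow_le_rpow_of_nonpos (by norm_num) hu (show -e ≤ 0 by linarith)
  have h2 := Real.rpow_le_rpow_of_exponent_ge (by norm_num) (by norm_num : (1 / 4 : ℝ) ≤ 1)
    (show -1 ≤ -e by linarith)
  rw [Real.rpow_neg_one] at h2
  linarith

/-- The points `0`, `a`, `b = a + 1` are at mutual distance at least `1/2`, so at most one of the
three factors has base below `1/4`. The other two are at most `4` each, whence `16`. -/
theorem norm_integrand_le (z : ℂ) : ‖integrand z‖ ≤ 16 * (1 + (‖z‖ ^ (-(9 / 10) : ℝ) +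
    ‖z - (a : ℂ)‖ ^ (-(9 / 10) : ℝ) + ‖z - (b : ℂ)‖ ^ (-(9 / 10) : ℝ))) := by
  have t1 : a ≤ ‖z‖ + ‖z - (a : ℂ)‖ := by
    have := norm_sub_le z (z - (a : ℂ))
    simpa [abs_of_pos a_pos] using this
  have t2 : b ≤ ‖z‖ + ‖z - (b : ℂ)‖ := by
    have := norm_sub_le z (z - (b : ℂ))
    simpa [abs_of_pos b_pos] using this
  have t3 : b - a ≤ ‖z - (a : ℂ)‖ + ‖z - (b : ℂ)‖ := by
    have := norm_sub_le (z - (a : ℂ)) (z - (b : ℂ))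
    have e : z - (a : ℂ) - (z - (b : ℂ)) = ((b - a : ℝ) : ℂ) := by push_cast; ring
    rw [e, Complex.norm_real, Real.norm_eq_abs] at this
    exact (le_abs_self _).trans this
  rw [norm_integrand]
  have h1 := norm_nonneg z
  have h2 := norm_nonneg (z - (a : ℂ))
  have h3 := norm_nonneg (z - (b : ℂ))
  generalize ‖z‖ = u at *
  generalize ‖z - (a : ℂ)‖ = v at *
  generalize ‖z - (b : ℂ)‖ = w at *
  have b1 := rpow_neg_le_one_add h1 (e := 4 / 5) (by norm_num) (by norm_num)
  have b2 := rpow_neg_le_one_add h2 (e := 3 / 10) (by norm_num) (by norm_num)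
  have b3 := rpow_neg_le_one_add h3 (e := 9 / 10) (by norm_num) (by norm_num)
  have p1 := Real.rpow_nonneg h1 (-(9 / 10))
  have p2 := Real.rpow_nonneg h2 (-(9 / 10))
  have p3 := Real.rpow_nonneg h3 (-(9 / 10))
  have q1 := Real.rpow_nonneg h1 (-(4 / 5))
  have q2 := Real.rpow_nonneg h2 (-(3 / 10))
  have ha := half_le_a
  have hb := b_eq_add
  by_cases c1 : u < 1 / 4
  · have g2 := rpow_neg_le_four (u := v) (e := 3 / 10) (by linarith) (by norm_num) (by norm_num)
    have g3 := rpow_neg_le_four (u := w) (e := 9 / 10) (by linarith) (by norm_num) (by norm_num)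
    calc _ ≤ (1 + u ^ (-(9 / 10) : ℝ)) * 4 * 4 := by gcongr
      _ ≤ _ := by linarith
  · have g1 := rpow_neg_le_four (u := u) (e := 4 / 5) (by linarith) (by norm_num) (by norm_num)
    by_cases c2 : v < 1 / 4
    · have g3 := rpow_neg_le_four (u := w) (e := 9 / 10) (by linarith) (by norm_num) (by norm_num)
      calc _ ≤ 4 * (1 + v ^ (-(9 / 10) : ℝ)) * 4 := by gcongr
        _ ≤ _ := by linarith
    · have g2 := rpow_neg_le_four (u := v) (e := 3 / 10) (by linarith) (by norm_num) (by norm_num)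
      calc _ ≤ 4 * 4 * (1 + w ^ (-(9 / 10) : ℝ)) := by gcongr
        _ ≤ _ := by linarith

open MeasureTheory

/-! ### The primitive of the integrand -/

/-- The primitive of the integrand that vanishes at infinity. -/
def primitive (z : ℂ) : ℂ :=
  -Complex.I * ∫ s in Ioi (0 : ℝ), integrand (z + (s : ℂ) * Complex.I)

theorem add_mul_I_mem_slitDomain {z : ℂ} (hz : z ∈ slitDomain) {s : ℝ} (hs : 0 ≤ s) :
    z + (s : ℂ) * Complex.I ∈ slitDomain := by
  rcases hz with h | h
  · exact Or.inl (by simp; linarith)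
  · exact Or.inr (by simpa using h)

theorem exists_lower_bound (w : ℂ) (hw : 0 < w.im ∨ w.re ≠ 0) :
    ∃ c > 0, ∃ r > 0, ∀ z ∈ Metric.ball w r, ∀ s : ℝ, 0 ≤ s →
      c * (1 + s) ≤ ‖z + (s : ℂ) * Complex.I‖ := by
  obtain ⟨d, hd, r, hr, h⟩ : ∃ d > 0, ∃ r > 0, ∀ z ∈ Metric.ball w r, ∀ s : ℝ, 0 ≤ s →
      d ≤ ‖z + (s : ℂ) * Complex.I‖ := by
    rcases hw with h | h
    · refine ⟨w.im / 2, by linarith, w.im / 2, by linarith, fun z hz s hs => ?_⟩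
      have h1 := (Complex.abs_im_le_norm (z - w)).trans_lt (mem_ball_iff_norm.1 hz)
      have h2 := (le_abs_self _).trans (Complex.abs_im_le_norm (z + (s : ℂ) * Complex.I))
      simp at h1 h2
      have := abs_lt.1 h1
      linarith
    · have h' := abs_pos.2 h
      refine ⟨|w.re| / 2, by linarith, |w.re| / 2, by linarith, fun z hz s hs => ?_⟩
      have h1 := (Complex.abs_re_le_norm (z - w)).trans_lt (mem_ball_iff_norm.1 hz)
      have h2 := Complex.abs_re_le_norm (z + (s : ℂ) * Complex.I)
      simp at h1 h2
      have := abs_sub_abs_le_abs_sub w.re z.re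
      rw [abs_sub_comm] at this
      linarith
  set M : ℝ := ‖w‖ + r
  have hM : 0 ≤ M := by positivity
  -- For `X = ‖z + s i‖`, adding `1 + M` times `X ≥ d` to `d` times `X ≥ s - M` gives `(d + 1 + M) X
  -- ≥ d (1 + s)`.
  refine ⟨d / (d + 1 + M), by positivity, r, hr, fun z hz s hs => ?_⟩
  have h1 := h z hz s hs
  have h2 : s - M ≤ ‖z + (s : ℂ) * Complex.I‖ := by
    have e1 : s ≤ ‖z + (s : ℂ) * Complex.I‖ + ‖z‖ := by
      have := norm_sub_le (z + (s : ℂ) * Complex.I) z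
      simpa [abs_of_nonneg hs] using this
    have e2 : ‖z‖ ≤ ‖w‖ + r := by
      have := norm_sub_norm_le z w
      have := mem_ball_iff_norm.1 hz
      linarith
    linarith
  rw [div_mul_eq_mul_div, div_le_iff₀ (by positivity)]
  generalize ‖z + (s : ℂ) * Complex.I‖ = X at *
  nlinarith

theorem exists_lower_bound_singularities {z₀ : ℂ} (h₀ : z₀ ∈ slitDomain) :
    ∃ c > 0, ∃ r > 0, Metric.ball z₀ r ⊆ slitDomain ∧ ∀ z ∈ Metric.ball z₀ r, ∀ s : ℝ, 0 ≤ s →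
      c * (1 + s) ≤ ‖z + (s : ℂ) * Complex.I‖ ∧
      c * (1 + s) ≤ ‖z + (s : ℂ) * Complex.I - (a : ℂ)‖ ∧
      c * (1 + s) ≤ ‖z + (s : ℂ) * Complex.I - (b : ℂ)‖ := by
  have key : ∀ p : ℝ, (0 < z₀.im ∨ z₀.re ≠ p) → ∃ c > 0, ∃ r > 0, ∀ z ∈ Metric.ball z₀ r, ∀ s : ℝ,
      0 ≤ s → c * (1 + s) ≤ ‖z + (s : ℂ) * Complex.I - (p : ℂ)‖ := by
    intro p hp
    obtain ⟨c, hc, r, hr, h⟩ := exists_lower_bound (z₀ - (p : ℂ)) (by simpa [sub_eq_zero] using hp)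
    refine ⟨c, hc, r, hr, fun z hz s hs => ?_⟩
    have := h (z - (p : ℂ)) (by simpa [mem_ball_iff_norm] using hz) s hs
    rwa [sub_add_eq_add_sub] at this
  obtain ⟨c₁, hc₁, r₁, hr₁, H₁⟩ := key 0 (h₀.imp_right fun h => h.1)
  obtain ⟨c₂, hc₂, r₂, hr₂, H₂⟩ := key a (h₀.imp_right fun h => h.2.1)
  obtain ⟨c₃, hc₃, r₃, hr₃, H₃⟩ := key b (h₀.imp_right fun h => h.2.2)
  obtain ⟨r₄, hr₄, H₄⟩ := Metric.isOpen_iff.1 isOpen_slitDomain z₀ h₀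
  refine ⟨min c₁ (min c₂ c₃), by positivity, min (min r₁ r₂) (min r₃ r₄), by positivity,
    (Metric.ball_subset_ball (by simp)).trans H₄, fun z hz s hs => ?_⟩
  have hz₁ : z ∈ Metric.ball z₀ r₁ := Metric.ball_subset_ball (by simp) hz
  have hz₂ : z ∈ Metric.ball z₀ r₂ := Metric.ball_subset_ball (by simp) hz
  have hz₃ : z ∈ Metric.ball z₀ r₃ := Metric.ball_subset_ball (by simp) hz
  have h1 := H₁ z hz₁ s hs
  rw [Complex.ofReal_zero, sub_zero] at h1
  refine ⟨le_trans ?_ h1, le_trans ?_ (H₂ z hz₂ s hs), le_trans ?_ (H₃ z hz₃ s hs)⟩ <;> gcongr <;>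
    simp

theorem continuousOn_integrand : ContinuousOn integrand slitDomain := fun _ hz =>
  (hasDerivAt_integrand hz).continuousAt.continuousWithinAt

theorem continuousOn_integrandDeriv : ContinuousOn integrandDeriv slitDomain := by
  have h1 : ∀ z ∈ slitDomain, z ≠ 0 := fun z hz => (slitDomain_ne hz).1
  have h2 : ∀ z ∈ slitDomain, z - (a : ℂ) ≠ 0 := fun z hz => (slitDomain_ne hz).2.1
  have h3 : ∀ z ∈ slitDomain, z - (b : ℂ) ≠ 0 := fun z hz => (slitDomain_ne hz).2.2
  unfold integrandDeriv
  exact continuousOn_integrand.mul (((continuousOn_const.div continuousOn_id h1).sub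
    (continuousOn_const.div (by fun_prop) h2)).sub (continuousOn_const.div (by fun_prop) h3))

theorem inv_sq_le {c s : ℝ} (hc : 0 < c) (hs : 0 ≤ s) :
    ((c * (1 + s)) ^ 2)⁻¹ ≤ (c ^ 2)⁻¹ * (1 + s ^ 2)⁻¹ := by
  rw [mul_pow, mul_inv]
  gcongr
  nlinarith

theorem norm_integrandDeriv_le {z : ℂ} {c x : ℝ} (hc : 0 < c) (hx : c ≤ x) (h1 : x ≤ ‖z‖)
    (h2 : x ≤ ‖z - (a : ℂ)‖) (h3 : x ≤ ‖z - (b : ℂ)‖) :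
    ‖integrandDeriv z‖ ≤ (x ^ 2)⁻¹ * (2 * c⁻¹) := by
  have hx0 := hc.trans_le hx
  rw [integrandDeriv, norm_mul]
  gcongr
  · exact norm_integrand_le_of_le hx0 h1 h2 h3
  · refine (norm_sub_le _ _).trans ((add_le_add_left (norm_sub_le _ _) _).trans ?_)
    have g : ∀ y : ℝ, x ≤ y → y⁻¹ ≤ c⁻¹ := fun y hy => inv_anti₀ hc (hx.trans hy)
    have g1 := g _ h1
    have g2 := g _ h2
    have g3 := g _ h3
    have n1 : ‖(-(4 / 5) / z : ℂ)‖ = 4 / 5 * ‖z‖⁻¹ := by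
      rw [norm_div, div_eq_mul_inv]; norm_num
    have n2 : ‖(3 / 10 / (z - (a : ℂ)) : ℂ)‖ = 3 / 10 * ‖z - (a : ℂ)‖⁻¹ := by
      rw [norm_div, div_eq_mul_inv]; norm_num
    have n3 : ‖(9 / 10 / (z - (b : ℂ)) : ℂ)‖ = 9 / 10 * ‖z - (b : ℂ)‖⁻¹ := by
      rw [norm_div, div_eq_mul_inv]; norm_num
    rw [n1, n2, n3]
    linarith

theorem continuousOn_vertical {g : ℂ → ℂ} (hg : ContinuousOn g slitDomain) {z : ℂ}
    (hz : z ∈ slitDomain) :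
    ContinuousOn (fun s : ℝ => g (z + (s : ℂ) * Complex.I)) (Ici 0) :=
  hg.comp (by fun_prop) fun _ hs => add_mul_I_mem_slitDomain hz hs

/-- Differentiation under the integral sign leaves the integral of the derivative along the vertical
ray, which is evaluated by the fundamental theorem: the contribution at infinity vanishes and the
one at `z₀` remains. Upward rays never meet the downward slits. -/
theorem hasDerivAt_primitive {z₀ : ℂ} (h₀ : z₀ ∈ slitDomain) :
    HasDerivAt primitive (integrand z₀) z₀ := by
  obtain ⟨c, hc, r, hr, hball, hlow⟩ := exists_lower_bound_singularities h₀
  have hint : ∀ z ∈ Metric.ball z₀ r, ∀ s ∈ Ici (0 : ℝ), ‖integrand (z + (s : ℂ) * Complex.I)‖ ≤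
      (c ^ 2)⁻¹ * (1 + s ^ 2)⁻¹ := by
    intro z hz s hs
    obtain ⟨l1, l2, l3⟩ := hlow z hz s hs
    have hs' : 0 ≤ s := hs
    exact (norm_integrand_le_of_le (by positivity) l1 l2 l3).trans (inv_sq_le hc hs)
  have hint' : ∀ z ∈ Metric.ball z₀ r, ∀ s ∈ Ici (0 : ℝ),
      ‖integrandDeriv (z + (s : ℂ) * Complex.I)‖ ≤
        (c ^ 2)⁻¹ * (1 + s ^ 2)⁻¹ * (2 * c⁻¹) := by
    intro z hz s hs
    obtain ⟨l1, l2, l3⟩ := hlow z hz s hs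
    have hs' : 0 ≤ s := hs
    refine (norm_integrandDeriv_le hc (by nlinarith) l1 l2 l3).trans ?_
    gcongr
    exact inv_sq_le hc hs
  have hb : Integrable (fun s : ℝ => (c ^ 2)⁻¹ * (1 + s ^ 2)⁻¹) (volume.restrict (Ioi 0)) :=
    (integrable_inv_one_add_sq.const_mul _).restrict
  have hmeas : ∀ {g : ℂ → ℂ}, ContinuousOn g slitDomain → ∀ z ∈ Metric.ball z₀ r,
      AEStronglyMeasurable (fun s : ℝ => g (z + (s : ℂ) * Complex.I)) (volume.restrict (Ioi 0)) :=
    fun hg z hz => ((continuousOn_vertical hg (hball hz)).mono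
      Ioi_subset_Ici_self).aestronglyMeasurable measurableSet_Ioi
  have hz₀ : z₀ ∈ Metric.ball z₀ r := Metric.mem_ball_self hr
  have hF_int : Integrable (fun s : ℝ => integrand (z₀ + (s : ℂ) * Complex.I))
      (volume.restrict (Ioi 0)) := by
    refine hb.mono' (hmeas continuousOn_integrand z₀ hz₀) ?_
    exact (ae_restrict_iff' measurableSet_Ioi).2 (Eventually.of_forall fun s hs =>
      hint z₀ hz₀ s (Ioi_subset_Ici_self hs))
  obtain ⟨hi, hder⟩ := hasDerivAt_integral_of_dominated_loc_of_deriv_le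
    (μ := volume.restrict (Ioi (0 : ℝ)))
    (F := fun z s => integrand (z + (s : ℂ) * Complex.I))
    (F' := fun z s => integrandDeriv (z + (s : ℂ) * Complex.I))
    (Metric.ball_mem_nhds z₀ hr)
    (by filter_upwards [Metric.ball_mem_nhds z₀ hr] with z hz using
      hmeas continuousOn_integrand z hz)
    hF_int (hmeas continuousOn_integrandDeriv z₀ hz₀)
    ((ae_restrict_iff' measurableSet_Ioi).2 (Eventually.of_forall fun s hs z hz =>
      hint' z hz s (Ioi_subset_Ici_self hs)))
    (hb.mul_const _)
    ((ae_restrict_iff' measurableSet_Ioi).2 (Eventually.of_forall fun s hs z hz =>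
      (hasDerivAt_integrand (add_mul_I_mem_slitDomain (hball hz)
        (le_of_lt hs))).comp_add_const z ((s : ℂ) * Complex.I)))
  have hlim : Tendsto (fun s : ℝ => integrand (z₀ + (s : ℂ) * Complex.I)) atTop (𝓝 0) := by
    have h1 : Tendsto (fun s : ℝ => (c ^ 2)⁻¹ * (1 + s ^ 2)⁻¹) atTop (𝓝 ((c ^ 2)⁻¹ * 0)) :=
      (tendsto_inv_atTop_zero.comp
        (tendsto_atTop_add_const_left _ _ (tendsto_pow_atTop two_ne_zero))).const_mul _
    rw [mul_zero] at h1
    refine squeeze_zero_norm' ?_ h1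
    filter_upwards [eventually_ge_atTop 0] with s hs using hint z₀ hz₀ s hs
  have hline : ∀ s : ℝ, HasDerivAt (fun s : ℝ => z₀ + (s : ℂ) * Complex.I) Complex.I s := by
    intro s
    simpa using ((Complex.ofRealCLM.hasDerivAt (x := s)).mul_const Complex.I).const_add z₀
  have hftc := integral_Ioi_of_hasDerivAt_of_tendsto
    ((continuousOn_vertical continuousOn_integrand h₀) 0 self_mem_Ici)
    (fun s hs => (hasDerivAt_integrand (add_mul_I_mem_slitDomain h₀ (le_of_lt hs))).comp_of_eq s
      (hline s) rfl) (hi.mul_const Complex.I) hlim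
  refine (hder.const_mul (-Complex.I)).congr_deriv ?_
  rw [integral_mul_const] at hftc
  simp only [Complex.ofReal_zero, zero_mul, add_zero, zero_sub] at hftc
  rw [neg_mul, mul_comm, hftc, neg_neg]

/-- From a point of the closed upper half plane, height `s` up the ray is at distance at least `s`
from every real point. Hence a bound by `s^{-9/10}` near `0` and by `s⁻²` beyond `1`, uniform even
at the branch points. -/
theorem exists_integrable_bound : ∃ g : ℝ → ℝ, IntegrableOn g (Ioi 0) ∧
    ∀ z ∈ upper, ∀ s ∈ Ioi (0 : ℝ), ‖integrand (z + (s : ℂ) * Complex.I)‖ ≤ g s := by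
  classical
  let g₁ : ℝ → ℝ := fun s => 16 * (1 + 3 * s ^ (-(9 / 10) : ℝ))
  let g₂ : ℝ → ℝ := fun s => s ^ (-2 : ℝ)
  refine ⟨(Iic (1 : ℝ)).piecewise g₁ g₂, ?_, ?_⟩
  · rw [← Ioc_union_Ioi_eq_Ioi zero_le_one, integrableOn_union]
    constructor
    · have : IntegrableOn g₁ (Ioc 0 1) := by
        rw [← intervalIntegrable_iff_integrableOn_Ioc_of_le zero_le_one]
        exact ((intervalIntegrable_const).add
          ((intervalIntegral.intervalIntegrable_rpow' (by norm_num)).const_mul 3)).const_mul 16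
      exact this.congr_fun (fun s hs => by simp [hs.2]) measurableSet_Ioc
    · have : IntegrableOn g₂ (Ioi 1) := integrableOn_Ioi_rpow_of_lt (by norm_num) one_pos
      refine this.congr_fun (fun s hs => ?_) measurableSet_Ioi
      rw [piecewise_eq_of_notMem _ _ _ (by simpa using hs)]
  · intro z hz s hs
    have hs' : 0 < s := hs
    have key : ∀ p : ℝ, s ≤ ‖z + (s : ℂ) * Complex.I - (p : ℂ)‖ := by
      intro p
      have h2 := (le_abs_self _).trans
        (Complex.abs_im_le_norm (z + (s : ℂ) * Complex.I - (p : ℂ)))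
      have hz' : 0 ≤ z.im := hz
      simp at h2
      linarith
    have k0 := key 0
    rw [Complex.ofReal_zero, sub_zero] at k0
    by_cases h : s ≤ 1
    · rw [piecewise_eq_of_mem _ _ _ (by simpa using h)]
      refine (norm_integrand_le _).trans ?_
      have m : ∀ y : ℝ, s ≤ y → y ^ (-(9 / 10) : ℝ) ≤ s ^ (-(9 / 10) : ℝ) := fun y hy =>
        Real.rpow_le_rpow_of_nonpos hs' hy (by norm_num)
      have := m _ k0
      have := m _ (key a)
      have := m _ (key b)
      simp only [g₁]
      linarith
    · rw [piecewise_eq_of_notMem _ _ _ (by simpa using h)]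
      refine (norm_integrand_le_of_le hs' k0 (key a) (key b)).trans_eq ?_
      simp only [g₂]
      rw [← Real.rpow_natCast, ← Real.rpow_neg hs'.le]
      norm_num

theorem add_mul_I_mem_slitDomain_of_mem_upper {z : ℂ} (hz : z ∈ upper) {s : ℝ} (hs : 0 < s) :
    z + (s : ℂ) * Complex.I ∈ slitDomain := by
  have hz' : 0 ≤ z.im := hz
  exact Or.inl (by simp; linarith)

/-- Dominated convergence along a general filter serves both continuity up to the real axis and the
limit at infinity. -/
theorem tendsto_integral_vertical {l : Filter ℂ} [l.IsCountablyGenerated] (hl : l ≤ 𝓟 upper)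
    {h : ℝ → ℂ} (hlim : ∀ s : ℝ, 0 < s →
      Tendsto (fun z => integrand (z + (s : ℂ) * Complex.I)) l (𝓝 (h s))) :
    Tendsto primitive l (𝓝 (-Complex.I * ∫ s in Ioi (0 : ℝ), h s)) := by
  obtain ⟨g, hg, hb⟩ := exists_integrable_bound
  have hu : ∀ᶠ z in l, z ∈ upper := le_principal_iff.1 hl
  refine Tendsto.const_mul _ (tendsto_integral_filter_of_dominated_convergence g ?_ ?_ hg ?_)
  · filter_upwards [hu] with z hz
    exact (continuousOn_integrand.comp (f := fun s : ℝ => z + (s : ℂ) * Complex.I) (by fun_prop)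
      fun s hs => add_mul_I_mem_slitDomain_of_mem_upper hz hs).aestronglyMeasurable
        measurableSet_Ioi
  · filter_upwards [hu] with z hz
    exact (ae_restrict_iff' measurableSet_Ioi).2 (Eventually.of_forall (hb z hz))
  · exact (ae_restrict_iff' measurableSet_Ioi).2 (Eventually.of_forall hlim)

theorem continuousOn_primitive : ContinuousOn primitive upper := by
  intro z₀ h₀
  refine tendsto_integral_vertical inf_le_right fun s hs => ?_
  have := (hasDerivAt_integrand (add_mul_I_mem_slitDomain_of_mem_upper h₀ hs)).continuousAt
  exact (ContinuousAt.comp (f := fun z : ℂ => z + (s : ℂ) * Complex.I) this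
    (by fun_prop)).continuousWithinAt

theorem tendsto_primitive_cobounded :
    Tendsto primitive (Bornology.cobounded ℂ ⊓ 𝓟 upper) (𝓝 0) := by
  have : (Bornology.cobounded ℂ).IsCountablyGenerated := by
    rw [← comap_norm_atTop]
    infer_instance
  have h := tendsto_integral_vertical (l := Bornology.cobounded ℂ ⊓ 𝓟 upper) (h := fun _ => 0)
    inf_le_right ?_
  · simpa using h
  · intro s hs
    have h1 : Tendsto (fun z : ℂ => ((‖z‖ - (s + b)) ^ 2)⁻¹) (Bornology.cobounded ℂ ⊓ 𝓟 upper)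
        (𝓝 0) :=
      (tendsto_inv_atTop_zero.comp ((tendsto_pow_atTop two_ne_zero).comp
        (tendsto_atTop_add_const_right _ _ tendsto_norm_cobounded_atTop))).mono_left inf_le_left
    refine squeeze_zero_norm' ?_ h1
    have h2 : ∀ᶠ z in Bornology.cobounded ℂ ⊓ 𝓟 upper, s + b < ‖z‖ :=
      (tendsto_norm_cobounded_atTop.eventually (eventually_gt_atTop _)).filter_mono inf_le_left
    filter_upwards [h2] with z hz
    have key : ∀ p : ℝ, |p| ≤ b → ‖z‖ - (s + b) ≤ ‖z + (s : ℂ) * Complex.I - (p : ℂ)‖ := by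
      intro p hp
      have e : z = (z + (s : ℂ) * Complex.I - (p : ℂ)) - (s : ℂ) * Complex.I + (p : ℂ) := by ring
      have e1 := norm_add_le (z + (s : ℂ) * Complex.I - (p : ℂ) - (s : ℂ) * Complex.I) (p : ℂ)
      have e2 := norm_sub_le (z + (s : ℂ) * Complex.I - (p : ℂ)) ((s : ℂ) * Complex.I)
      rw [← e] at e1
      simp only [norm_mul, Complex.norm_real, Complex.norm_I, mul_one, Real.norm_eq_abs,
        abs_of_pos hs] at e1 e2
      linarith
    have k0 := key 0 (by simpa using b_pos.le)
    rw [Complex.ofReal_zero, sub_zero] at k0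
    exact norm_integrand_le_of_le (by linarith) k0
      (key a (by rw [abs_of_pos a_pos]; exact a_lt_b.le)) (key b (abs_of_pos b_pos).le)

theorem intervalIntegrable_norm_sub_rpow {ξ : ℂ} (hξ : ξ ≠ 0) (p : ℝ) :
    IntervalIntegrable (fun t : ℝ => ‖(t : ℂ) * ξ - (p : ℂ)‖ ^ (-(9 / 10) : ℝ)) volume 0 1 := by
  set q : ℂ := (p : ℂ) / ξ
  have h1 : IntervalIntegrable (fun x : ℝ => ‖(x : ℂ) ^ ((-(9 / 10) : ℝ) : ℂ)‖) volume
      (0 - q.re) (1 - q.re) :=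
    (intervalIntegral.intervalIntegrable_cpow' (by simp; norm_num)).norm
  have h2 : IntervalIntegrable (fun t : ℝ => |t - q.re| ^ (-(9 / 10) : ℝ)) volume 0 1 := by
    simpa only [Complex.norm_cpow_real, Complex.norm_real, Real.norm_eq_abs, sub_add_cancel] using
      h1.comp_sub_right q.re
  refine (h2.const_mul (‖ξ‖ ^ (-(9 / 10) : ℝ))).mono_fun ?_ ?_
  · have : Measurable (fun t : ℝ => ‖(t : ℂ) * ξ - (p : ℂ)‖ ^ (-(9 / 10) : ℝ)) := by
      fun_prop
    exact this.aestronglyMeasurable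
  -- At `t = q.re` the majorant is `0` by the convention for `0 ^ (-9/10)`, so this null point has
  -- to be discarded.
  · have hne : ∀ᵐ t : ℝ ∂volume.restrict (uIoc 0 1), t ≠ q.re :=
      ae_restrict_of_ae (by simp [ae_iff, measure_singleton])
    filter_upwards [hne] with t ht
    have e : (t : ℂ) * ξ - (p : ℂ) = ξ * ((t : ℂ) - q) := by
      simp only [q]
      field_simp
    have h3 : |t - q.re| ≤ ‖(t : ℂ) - q‖ := by
      simpa using Complex.abs_re_le_norm ((t : ℂ) - q)
    rw [e, norm_mul, Real.mul_rpow (norm_nonneg _) (norm_nonneg _), Real.norm_of_nonneg (by positivity),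
      Real.norm_of_nonneg (by positivity)]
    exact mul_le_mul_of_nonneg_left (Real.rpow_le_rpow_of_nonpos
      (abs_pos.2 (sub_ne_zero.2 ht)) h3 (by norm_num)) (by positivity)

theorem intervalIntegrable_integrand {ξ : ℂ} (hξ : ξ ≠ 0) :
    IntervalIntegrable (fun t : ℝ => integrand ((t : ℂ) * ξ)) volume 0 1 := by
  have h0 := intervalIntegrable_norm_sub_rpow hξ 0
  simp only [Complex.ofReal_zero, sub_zero] at h0
  refine ((intervalIntegrable_const (c := (1 : ℝ))).add
    ((h0.add (intervalIntegrable_norm_sub_rpow hξ a)).add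
      (intervalIntegrable_norm_sub_rpow hξ b)) |>.const_mul 16).mono_fun ?_ ?_
  · have : Measurable integrand := by
      unfold integrand
      fun_prop
    exact (this.comp (by fun_prop)).aestronglyMeasurable
  · refine Eventually.of_forall fun t => ?_
    refine (norm_integrand_le _).trans (le_trans ?_ (le_abs_self _))
    exact le_of_eq rfl

theorem smul_mem_upper {z : ℂ} (hz : z ∈ upper) {t : ℝ} (ht : 0 ≤ t) : (t : ℂ) * z ∈ upper := by
  have hz' : 0 ≤ z.im := hz
  change 0 ≤ ((t : ℂ) * z).im
  rw [Complex.im_ofReal_mul]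
  positivity

/-- The segment from `0` to `ξ` may run through branch points, but only at finitely many parameters,
which the fundamental theorem tolerates for a continuous primitive and an integrable derivative. -/
theorem calF_eq {ξ : ℂ} (hξ : ξ ∈ upper) : calF ξ = primitive ξ - primitive 0 := by
  rcases eq_or_ne ξ 0 with rfl | h0
  · simp [calF]
  have e : calF ξ = ∫ t in (0 : ℝ)..1, integrand ((t : ℂ) * ξ) * ξ := by
    refine intervalIntegral.integral_congr fun t ht => ?_
    rw [uIcc_of_le zero_le_one] at ht
    rw [integrand_eq_inv_etaBranch (smul_mem_upper hξ ht.1), div_eq_mul_inv, mul_comm]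
  have hs : ({0, (((a : ℂ)) / ξ).re, ((b : ℂ) / ξ).re} : Set ℝ).Countable := by simp
  rw [e, integral_eq_of_hasDerivAt_off_countable (fun t : ℝ => primitive ((t : ℂ) * ξ)) _ hs ?_ ?_
    ((intervalIntegrable_integrand h0).mul_const ξ)]
  · simp
  · rw [uIcc_of_le zero_le_one]
    exact continuousOn_primitive.comp (by fun_prop) fun t ht => smul_mem_upper hξ ht.1
  · intro t ht
    rw [min_eq_left zero_le_one, max_eq_right zero_le_one] at ht
    have hreg : (t : ℂ) * ξ ∈ slitDomain := by
      refine mem_slitDomain_of_mem_upper (smul_mem_upper hξ ht.1.1.le) fun hf => ht.2 ?_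
      have hre : ∀ p : ℂ, (t : ℂ) * ξ = p → t = (p / ξ).re := by
        rintro p rfl
        rw [mul_div_cancel_right₀ _ h0, Complex.ofReal_re]
      rcases f_eq_zero_iff.1 hf with h | h | h
      · exact Or.inl (by simpa using hre _ h)
      · exact Or.inr (Or.inl (hre _ h))
      · exact Or.inr (Or.inr (hre _ h))
    refine (hasDerivAt_primitive hreg).comp_of_eq t ?_ rfl
    simpa using (Complex.ofRealCLM.hasDerivAt (x := t)).mul_const ξ

theorem FT_eq {ξ : ℂ} (hξ : ξ ∈ upper) : FT ξ = (k : ℂ) * (primitive ξ - primitive 0) := by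
  rw [FT, calF_eq hξ]

/-! ### The images of the intervals of the real axis -/

/-- The ends of the interval are given as filters so that finite endpoints and `±∞` are treated
alike. -/
theorem image_eq_Ioo_of_strictMonoOn {h : ℝ → ℝ} {I : Set ℝ} (hI : IsPreconnected I)
    (hc : ContinuousOn h I) (hm : StrictMonoOn h I) {l₁ l₂ : Filter ℝ} [l₁.NeBot] [l₂.NeBot]
    (hl₁ : l₁ ≤ 𝓟 I) (hl₂ : l₂ ≤ 𝓟 I) (hlt₁ : ∀ x ∈ I, ∀ᶠ y in l₁, y < x)
    (hlt₂ : ∀ x ∈ I, ∀ᶠ y in l₂, x < y) {v₁ v₂ : ℝ} (hv₁ : Tendsto h l₁ (𝓝 v₁))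
    (hv₂ : Tendsto h l₂ (𝓝 v₂)) : h '' I = Ioo v₁ v₂ := by
  have m₁ : ∀ᶠ y in l₁, y ∈ I := le_principal_iff.1 hl₁
  have m₂ : ∀ᶠ y in l₂, y ∈ I := le_principal_iff.1 hl₂
  refine Subset.antisymm ?_ (hI.intermediate_value_Ioo hl₁ hl₂ hc hv₁ hv₂)
  rintro _ ⟨x, hx, rfl⟩
  constructor
  · obtain ⟨y, hy, hyI⟩ := ((hlt₁ x hx).and m₁).exists
    refine lt_of_le_of_lt ?_ (hm hyI hx hy)
    refine le_of_tendsto hv₁ ?_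
    filter_upwards [hlt₁ y hyI, m₁] with z hz hzI using (hm hzI hyI hz).le
  · obtain ⟨y, hy, hyI⟩ := ((hlt₂ x hx).and m₂).exists
    refine lt_of_lt_of_le (hm hx hyI hy) ?_
    refine ge_of_tendsto hv₂ ?_
    filter_upwards [hlt₂ y hyI, m₂] with z hz hzI using (hm hyI hzI hz).le

/-- A curve whose velocity has a constant direction traverses an open segment. -/
theorem image_eq_openSegment {g : ℝ → ℂ} {m : ℝ → ℝ} {ω : ℂ} (hω : ω ≠ 0) {I : Set ℝ}
    (hIo : IsOpen I) (hI : I.OrdConnected) (hne : I.Nonempty)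
    (hg : ∀ x ∈ I, HasDerivAt g (ω * m x) x) (hm : ∀ x ∈ I, 0 < m x) {l₁ l₂ : Filter ℝ} [l₁.NeBot]
    [l₂.NeBot] (hl₁ : l₁ ≤ 𝓟 I) (hl₂ : l₂ ≤ 𝓟 I) (hlt₁ : ∀ x ∈ I, ∀ᶠ y in l₁, y < x)
    (hlt₂ : ∀ x ∈ I, ∀ᶠ y in l₂, x < y) {v₁ v₂ : ℂ} (hv₁ : Tendsto g l₁ (𝓝 v₁))
    (hv₂ : Tendsto g l₂ (𝓝 v₂)) :
    (∃ L : ℝ, 0 < L ∧ v₂ = v₁ + L * ω) ∧ g '' I = openSegment ℝ v₁ v₂ := by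
  have hq : ∀ x ∈ I, HasDerivAt (fun x => g x / ω) (m x : ℂ) x := fun x hx =>
    ((hg x hx).div_const ω).congr_deriv (by field_simp)
  set h : ℝ → ℝ := fun x => (g x / ω).re
  have hre : ∀ x ∈ I, HasDerivAt h (m x) x := fun x hx => by
    exact (Complex.reCLM.hasFDerivAt.comp_hasDerivAt x (hq x hx)).congr_deriv (by simp)
  have him : ∀ x ∈ I, HasDerivAt (fun x => (((g x / ω).im : ℝ) : ℂ)) 0 x := fun x hx => by
    have := (Complex.ofRealCLM.comp Complex.imCLM).hasFDerivAt.comp_hasDerivAt x (hq x hx)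
    exact this.congr_deriv (by simp)
  obtain ⟨c', hc'⟩ := exists_const_of_hasDerivAt_zero hIo hI him
  obtain ⟨c, hc⟩ : ∃ c : ℝ, ∀ x ∈ I, (g x / ω).im = c := by
    refine ⟨c'.re, fun x hx => ?_⟩
    rw [← hc' x hx, Complex.ofReal_re]
  have hmono : StrictMonoOn h I := by
    refine strictMonoOn_of_deriv_pos hI.convex
      (fun x hx => (hre x hx).continuousAt.continuousWithinAt) fun x hx => ?_
    rw [hIo.interior_eq] at hx
    rw [(hre x hx).deriv]
    exact hm x hx
  have hdiv : Continuous fun z : ℂ => z / ω := continuous_id.div_const ω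
  have hcont : ContinuousOn h I := fun x hx => (hre x hx).continuousAt.continuousWithinAt
  have himage := image_eq_Ioo_of_strictMonoOn hI.isPreconnected hcont hmono hl₁ hl₂ hlt₁ hlt₂
    (((Complex.continuous_re.comp hdiv).tendsto v₁).comp hv₁)
    (((Complex.continuous_re.comp hdiv).tendsto v₂).comp hv₂)
  simp only [Function.comp] at himage
  have hc₁ : (v₁ / ω).im = c := by
    refine tendsto_nhds_unique (((Complex.continuous_im.comp hdiv).tendsto v₁).comp hv₁) ?_
    refine tendsto_const_nhds.congr' ?_
    filter_upwards [le_principal_iff.1 hl₁] with x hx using (hc x hx).symm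
  have hc₂ : (v₂ / ω).im = c := by
    refine tendsto_nhds_unique (((Complex.continuous_im.comp hdiv).tendsto v₂).comp hv₂) ?_
    refine tendsto_const_nhds.congr' ?_
    filter_upwards [le_principal_iff.1 hl₂] with x hx using (hc x hx).symm
  have hlt : (v₁ / ω).re < (v₂ / ω).re := by
    obtain ⟨x, hx⟩ := hne
    have := himage ▸ mem_image_of_mem h hx
    exact this.1.trans this.2
  have e : ∀ z : ℂ, (z / ω).im = c → z = ((z / ω).re + c * Complex.I) * ω := fun z hz => by
    rw [← hz, Complex.re_add_im, div_mul_cancel₀ _ hω]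
  have e₁ := e v₁ hc₁
  have e₂ := e v₂ hc₂
  set x₁ := (v₁ / ω).re
  set x₂ := (v₂ / ω).re
  refine ⟨⟨x₂ - x₁, sub_pos.2 hlt, ?_⟩, ?_⟩
  · rw [e₁, e₂]
    push_cast
    ring
  · rw [openSegment_eq_image', e₁, e₂]
    ext z
    constructor
    · rintro ⟨x, hx, rfl⟩
      have hh := himage ▸ mem_image_of_mem h hx
      refine ⟨(h x - x₁) / (x₂ - x₁), ⟨div_pos (sub_pos.2 hh.1) (sub_pos.2 hlt), ?_⟩, ?_⟩
      · rw [div_lt_one (sub_pos.2 hlt)]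
        linarith [hh.2]
      · simp only
        rw [e (g x) (hc x hx), Complex.real_smul]
        have : ((x₂ - x₁ : ℝ) : ℂ) ≠ 0 := by exact_mod_cast (sub_pos.2 hlt).ne'
        push_cast at this ⊢
        field_simp
        simp only [h]
        ring
    · rintro ⟨θ, hθ, rfl⟩
      obtain ⟨x, hx, hhx⟩ : x₁ + θ * (x₂ - x₁) ∈ h '' I := by
        rw [himage]
        constructor <;> nlinarith [hθ.1, hθ.2]
      refine ⟨x, hx, ?_⟩
      rw [e (g x) (hc x hx)]
      change ((h x : ℂ) + _) * ω = _
      simp only [hhx, Complex.real_smul]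
      push_cast
      ring

/-- For real `r` the number `-i r` has argument `-π/2` or `π/2`, according to the sign of `r`. -/
theorem neg_I_mul_ofReal_cpow {r : ℝ} (hr : r ≠ 0) (c : ℝ) :
    (-Complex.I * r) ^ (c : ℂ)
      = Complex.exp ((-(c * (π / 2) * Real.sign r) : ℝ) * Complex.I) *
        (‖(-Complex.I * r) ^ (c : ℂ)‖ : ℝ) := by
  have h0 : -Complex.I * (r : ℂ) ≠ 0 := mul_ne_zero (by simp) (by exact_mod_cast hr)
  have harg : (-Complex.I * (r : ℂ)).arg = -(π / 2 * Real.sign r) := by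
    rcases hr.lt_or_gt with h | h
    · rw [Real.sign_of_neg h, show -Complex.I * (r : ℂ) = Complex.I * ((-r : ℝ) : ℂ) by
        push_cast; ring, Complex.arg_mul_real (neg_pos.2 h), Complex.arg_I]
      ring
    · rw [Real.sign_of_pos h, Complex.arg_mul_real h, Complex.arg_neg_I]
      ring
  have hpos : 0 < ‖-Complex.I * (r : ℂ)‖ := norm_pos_iff.2 h0
  rw [Complex.norm_cpow_real, Real.rpow_def_of_pos hpos, Complex.cpow_def_of_ne_zero h0,
    Complex.ofReal_exp, ← Complex.exp_add, Complex.log, harg]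
  congr 1
  push_cast
  ring

/-- On the real axis, the argument of the integrand is locally constant. -/
theorem integrand_ofReal {x : ℝ} (h0 : x ≠ 0) (h1 : x ≠ a) (h2 : x ≠ b) :
    integrand x = Complex.exp ((π / 5 + 2 * π / 5 * Real.sign x + 3 * π / 20 * Real.sign (x - a) +
      9 * π / 20 * Real.sign (x - b) : ℝ) * Complex.I) * (‖integrand x‖ : ℝ) := by
  have e1 := neg_I_mul_ofReal_cpow h0 (-(4 / 5))
  have e2 := neg_I_mul_ofReal_cpow (sub_ne_zero.2 h1) (-(3 / 10))
  have e3 := neg_I_mul_ofReal_cpow (sub_ne_zero.2 h2) (-(9 / 10))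
  rw [Complex.ofReal_sub] at e2 e3
  have hn : ‖integrand x‖ = ‖(-Complex.I * (x : ℂ)) ^ ((-(4 / 5) : ℝ) : ℂ)‖ *
      ‖(-Complex.I * ((x : ℂ) - (a : ℂ))) ^ ((-(3 / 10) : ℝ) : ℂ)‖ *
      ‖(-Complex.I * ((x : ℂ) - (b : ℂ))) ^ ((-(9 / 10) : ℝ) : ℂ)‖ := by
    rw [integrand, norm_mul, norm_mul, norm_mul, Complex.norm_exp_ofReal_mul_I, one_mul]
  rw [hn, integrand]
  generalize ‖(-Complex.I * (x : ℂ)) ^ ((-(4 / 5) : ℝ) : ℂ)‖ = n1 at *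
  generalize ‖(-Complex.I * ((x : ℂ) - (a : ℂ))) ^ ((-(3 / 10) : ℝ) : ℂ)‖ = n2 at *
  generalize ‖(-Complex.I * ((x : ℂ) - (b : ℂ))) ^ ((-(9 / 10) : ℝ) : ℂ)‖ = n3 at *
  rw [e1, e2, e3]
  have hexp : ∀ t₀ t₁ t₂ t₃ : ℝ, Complex.exp ((t₀ + t₁ + t₂ + t₃ : ℝ) * Complex.I) =
      Complex.exp (t₀ * Complex.I) * Complex.exp (t₁ * Complex.I) * Complex.exp (t₂ * Complex.I) *
        Complex.exp (t₃ * Complex.I) := by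
    intro t₀ t₁ t₂ t₃
    rw [← Complex.exp_add, ← Complex.exp_add, ← Complex.exp_add]
    push_cast
    ring_nf
  rw [hexp, show -(-(4 / 5) * (π / 2) * x.sign) = 2 * π / 5 * x.sign by ring,
    show -(-(3 / 10) * (π / 2) * (x - a).sign) = 3 * π / 20 * (x - a).sign by ring,
    show -(-(9 / 10) * (π / 2) * (x - b).sign) = 9 * π / 20 * (x - b).sign by ring]
  push_cast
  ring

theorem ofReal_mem_upper (x : ℝ) : (x : ℂ) ∈ upper := by
  change 0 ≤ (x : ℂ).im
  simp

theorem ofReal_mem_slitDomain {x : ℝ} (h0 : x ≠ 0) (h1 : x ≠ a) (h2 : x ≠ b) :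
    (x : ℂ) ∈ slitDomain := Or.inr ⟨h0, h1, h2⟩

theorem tendsto_primitive_ofReal (x : ℝ) (s : Set ℝ) :
    Tendsto (fun y : ℝ => primitive y) (𝓝[s] x) (𝓝 (primitive x)) := by
  have h : Continuous fun y : ℝ => primitive y :=
    continuousOn_primitive.comp_continuous Complex.continuous_ofReal ofReal_mem_upper
  exact h.continuousAt.continuousWithinAt

theorem hasDerivAt_primitive_ofReal {x θ : ℝ} (h0 : x ≠ 0) (h1 : x ≠ a) (h2 : x ≠ b)
    (hθ : π / 5 + 2 * π / 5 * Real.sign x + 3 * π / 20 * Real.sign (x - a) +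
      9 * π / 20 * Real.sign (x - b) = θ) (κ : ℝ) :
    HasDerivAt (fun y : ℝ => (κ : ℂ) * (primitive y - primitive 0))
      (Complex.exp (θ * Complex.I) * (κ * ‖integrand x‖ : ℝ)) x := by
  have h := (((hasDerivAt_primitive (ofReal_mem_slitDomain h0 h1 h2)).comp_ofReal).sub_const
    (primitive 0)).const_mul (κ : ℂ)
  refine h.congr_deriv ?_
  rw [integrand_ofReal h0 h1 h2, hθ]
  simp only [norm_mul, Complex.norm_exp_ofReal_mul_I, Complex.norm_real, norm_norm]
  push_cast
  ring

theorem norm_integrand_ofReal_pos {x : ℝ} (h0 : x ≠ 0) (h1 : x ≠ a) (h2 : x ≠ b) :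
    0 < ‖integrand x‖ :=
  norm_pos_iff.2 (integrand_ne_zero (ofReal_mem_slitDomain h0 h1 h2))

/-- The factor `κ` is left free because the case `κ = 1` is what proves `k > 0`, after which `κ = k`
is used. -/
theorem image_Ioo {κ x₁ x₂ θ : ℝ} (hκ : 0 < κ) (hx : x₁ < x₂)
    (hreg : ∀ x ∈ Ioo x₁ x₂, x ≠ 0 ∧ x ≠ a ∧ x ≠ b)
    (hθ : ∀ x ∈ Ioo x₁ x₂, π / 5 + 2 * π / 5 * Real.sign x + 3 * π / 20 * Real.sign (x - a) +
      9 * π / 20 * Real.sign (x - b) = θ) :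
    (∃ L : ℝ, 0 < L ∧ (κ : ℂ) * (primitive x₂ - primitive 0) =
      (κ : ℂ) * (primitive x₁ - primitive 0) + L * Complex.exp (θ * Complex.I)) ∧
    (fun y : ℝ => (κ : ℂ) * (primitive y - primitive 0)) '' Ioo x₁ x₂ =
      openSegment ℝ ((κ : ℂ) * (primitive x₁ - primitive 0))
        ((κ : ℂ) * (primitive x₂ - primitive 0)) := by
  have := left_nhdsWithin_Ioo_neBot hx
  have := right_nhdsWithin_Ioo_neBot hx
  refine image_eq_openSegment (Complex.exp_ne_zero _) isOpen_Ioo ordConnected_Ioo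
    (nonempty_Ioo.2 hx) (fun x hx => hasDerivAt_primitive_ofReal (hreg x hx).1 (hreg x hx).2.1
      (hreg x hx).2.2 (hθ x hx) κ)
    (fun x hx => mul_pos hκ
      (norm_integrand_ofReal_pos (hreg x hx).1 (hreg x hx).2.1 (hreg x hx).2.2))
    (l₁ := 𝓝[Ioo x₁ x₂] x₁) (l₂ := 𝓝[Ioo x₁ x₂] x₂) inf_le_right inf_le_right
    (fun x hx => mem_nhdsWithin_of_mem_nhds (Iio_mem_nhds hx.1))
    (fun x hx => mem_nhdsWithin_of_mem_nhds (Ioi_mem_nhds hx.2))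
    (((tendsto_primitive_ofReal _ _).sub_const _).const_mul _)
    (((tendsto_primitive_ofReal _ _).sub_const _).const_mul _)

theorem image_Ioo_zero_a {κ : ℝ} (hκ : 0 < κ) :
    (∃ L : ℝ, 0 < L ∧ (κ : ℂ) * (primitive a - primitive 0) = L) ∧
    (fun y : ℝ => (κ : ℂ) * (primitive y - primitive 0)) '' Ioo 0 a =
      openSegment ℝ 0 ((κ : ℂ) * (primitive a - primitive 0)) := by
  have h := image_Ioo (θ := 0) hκ a_pos
    (fun x hx => ⟨hx.1.ne', hx.2.ne, (hx.2.trans a_lt_b).ne⟩) (fun x hx => by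
      rw [Real.sign_of_pos hx.1, Real.sign_of_neg (sub_neg.2 hx.2),
        Real.sign_of_neg (sub_neg.2 (hx.2.trans a_lt_b))]
      ring)
  simpa using h

/-! ### The normalised developing map and the position of its vertices -/

theorem k_pos : 0 < k := by
  obtain ⟨⟨L, hL, h⟩, -⟩ := image_Ioo_zero_a one_pos
  rw [k, calF_eq (ofReal_mem_upper a)]
  rw [Complex.ofReal_one, one_mul] at h
  rw [h, Complex.ofReal_re]
  exact div_pos a_pos hL

/-- The Schwarz-Christoffel map, continued to the slit plane. -/
def develop (z : ℂ) : ℂ := (k : ℂ) * (primitive z - primitive 0)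

/-- The value of the Schwarz-Christoffel map at infinity. -/
def ptP : ℂ := -((k : ℂ) * primitive 0)

theorem develop_zero : develop 0 = 0 := by simp [develop]

theorem develop_a : develop a = a := by
  obtain ⟨⟨L, hL, h⟩, -⟩ := image_Ioo_zero_a one_pos
  rw [Complex.ofReal_one, one_mul] at h
  have hk : k = a / L := by
    rw [k, calF_eq (ofReal_mem_upper a), h, Complex.ofReal_re]
  have : (L : ℂ) ≠ 0 := by exact_mod_cast hL.ne'
  rw [develop, h, hk]
  push_cast
  field_simp

theorem hasDerivAt_develop {z : ℂ} (hz : z ∈ slitDomain) :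
    HasDerivAt develop (k * integrand z) z :=
  ((hasDerivAt_primitive hz).sub_const _).const_mul _

theorem isDetermination_develop : IsDetermination slitDomain develop where
  isOpen := isOpen_slitDomain
  differentiableOn := fun _ hz => (hasDerivAt_develop hz).differentiableAt.differentiableWithinAt
  deriv_pow := fun z hz => by
    rw [(hasDerivAt_develop hz).deriv, mul_pow, mul_assoc, integrand_pow_mul hz, mul_one]

theorem continuousOn_develop : ContinuousOn develop upper :=
  continuousOn_const.mul (continuousOn_primitive.sub continuousOn_const)

theorem tendsto_develop : Tendsto develop (Bornology.cobounded ℂ ⊓ 𝓟 upper) (𝓝 ptP) := by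
  have := (tendsto_primitive_cobounded.sub_const (primitive 0)).const_mul (k : ℂ)
  rwa [zero_sub, mul_neg] at this

theorem tendsto_develop_ofReal {l : Filter ℝ} (hl : l ≤ Bornology.cobounded ℝ) :
    Tendsto (fun x : ℝ => develop x) l (𝓝 ptP) := by
  refine tendsto_develop.comp (tendsto_inf.2 ⟨?_, ?_⟩)
  · rw [← tendsto_norm_atTop_iff_cobounded]
    simpa only [Complex.norm_real] using tendsto_norm_cobounded_atTop.mono_left hl
  · exact tendsto_principal.2 (Eventually.of_forall ofReal_mem_upper)

theorem develop_image_Ioo_zero_a :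
    (fun x : ℝ => develop x) '' Ioo 0 a = openSegment ℝ 0 (a : ℂ) := by
  have := (image_Ioo_zero_a k_pos).2
  have e : (k : ℂ) * (primitive a - primitive 0) = a := develop_a
  rwa [e] at this

theorem develop_image_Ioo_a_b :
    (∃ L : ℝ, 0 < L ∧ develop b = a + L * Complex.exp ((3 * π / 10 : ℝ) * Complex.I)) ∧
    (fun x : ℝ => develop x) '' Ioo a b = openSegment ℝ (a : ℂ) (develop b) := by
  have h := image_Ioo (θ := 3 * π / 10) k_pos a_lt_b
    (fun x hx => ⟨(a_pos.trans hx.1).ne', hx.1.ne', hx.2.ne⟩) (fun x hx => by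
      rw [Real.sign_of_pos (a_pos.trans hx.1), Real.sign_of_pos (sub_pos.2 hx.1),
        Real.sign_of_neg (sub_neg.2 hx.2)]
      ring)
  have e : (k : ℂ) * (primitive a - primitive 0) = a := develop_a
  rwa [e] at h

theorem develop_image_Ioi_b :
    (∃ L : ℝ, 0 < L ∧ ptP = develop b + L * Complex.exp ((6 * π / 5 : ℝ) * Complex.I)) ∧
    (fun x : ℝ => develop x) '' Ioi b = openSegment ℝ (develop b) ptP := by
  have hreg : ∀ x ∈ Ioi b, x ≠ 0 ∧ x ≠ a ∧ x ≠ b := fun x hx =>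
    ⟨(b_pos.trans hx).ne', (a_lt_b.trans hx).ne', (mem_Ioi.1 hx).ne'⟩
  refine image_eq_openSegment (Complex.exp_ne_zero _) isOpen_Ioi ordConnected_Ioi
    nonempty_Ioi (fun x hx => hasDerivAt_primitive_ofReal (hreg x hx).1 (hreg x hx).2.1
      (hreg x hx).2.2 ?_ k)
    (fun x hx => mul_pos k_pos
      (norm_integrand_ofReal_pos (hreg x hx).1 (hreg x hx).2.1 (hreg x hx).2.2))
    (l₁ := 𝓝[>] b) (l₂ := atTop) inf_le_right (le_principal_iff.2 (Ioi_mem_atTop b))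
    (fun x hx => mem_nhdsWithin_of_mem_nhds (Iio_mem_nhds hx))
    (fun x _ => eventually_gt_atTop x)
    (((tendsto_primitive_ofReal _ _).sub_const _).const_mul _)
    (tendsto_develop_ofReal IsOrderBornology.atTop_le_cobounded)
  rw [Real.sign_of_pos (b_pos.trans hx), Real.sign_of_pos (sub_pos.2 (a_lt_b.trans hx)),
    Real.sign_of_pos (sub_pos.2 hx)]
  ring

theorem develop_image_Iio_zero :
    (∃ L : ℝ, 0 < L ∧ 0 = ptP + L * Complex.exp ((-(4 * π / 5) : ℝ) * Complex.I)) ∧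
    (fun x : ℝ => develop x) '' Iio 0 = openSegment ℝ ptP 0 := by
  have hreg : ∀ x ∈ Iio (0 : ℝ), x ≠ 0 ∧ x ≠ a ∧ x ≠ b := fun x hx =>
    ⟨(mem_Iio.1 hx).ne, ((mem_Iio.1 hx).trans a_pos).ne, ((mem_Iio.1 hx).trans b_pos).ne⟩
  have h0 : Tendsto (fun x : ℝ => develop x) (𝓝[<] 0) (𝓝 0) := by
    have := ((tendsto_primitive_ofReal 0 (Iio 0)).sub_const (primitive 0)).const_mul (k : ℂ)
    simpa [develop] using this
  refine image_eq_openSegment (Complex.exp_ne_zero _) isOpen_Iio ordConnected_Iio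
    nonempty_Iio (fun x hx => hasDerivAt_primitive_ofReal (hreg x hx).1 (hreg x hx).2.1
      (hreg x hx).2.2 ?_ k)
    (fun x hx => mul_pos k_pos
      (norm_integrand_ofReal_pos (hreg x hx).1 (hreg x hx).2.1 (hreg x hx).2.2))
    (l₁ := atBot) (l₂ := 𝓝[<] 0) (le_principal_iff.2 (Iio_mem_atBot 0)) inf_le_right
    (fun x _ => eventually_lt_atBot x)
    (fun x hx => mem_nhdsWithin_of_mem_nhds (Ioi_mem_nhds hx))
    (tendsto_develop_ofReal IsOrderBornology.atBot_le_cobounded) h0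
  have hx' : x < 0 := hx
  rw [Real.sign_of_neg hx', Real.sign_of_neg (sub_neg.2 (hx'.trans a_pos)),
    Real.sign_of_neg (sub_neg.2 (hx'.trans b_pos))]
  ring

theorem sin_pi_div_five_pos : 0 < Real.sin (π / 5) :=
  Real.sin_pos_of_pos_of_lt_pi (by positivity) (by linarith [Real.pi_pos])

/-- The image of `(a, b)` leaves `A` in direction `3π/10`. The images of `(b, ∞)` and `(-∞, 0)` have
the same direction, opposite to `π/5`, so together they form one side from the image of `b` through
`P` to `O`. Two lines then determine `B`, and the law of sines gives `|OB| = b`. -/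
theorem develop_b_and_ptP : develop b = ptB ∧
    ∃ x : ℝ, 0 < x ∧ x < 1 ∧ ptP = (x : ℂ) * ptB := by
  obtain ⟨⟨L₂, h₂, e₂⟩, -⟩ := develop_image_Ioo_a_b
  obtain ⟨⟨L₃, h₃, e₃⟩, -⟩ := develop_image_Ioi_b
  obtain ⟨⟨L₄, h₄, e₄⟩, -⟩ := develop_image_Iio_zero
  have x₃ : Complex.exp ((6 * π / 5 : ℝ) * Complex.I) =
      -Complex.exp ((π / 5 : ℝ) * Complex.I) := by
    rw [← Complex.exp_add_pi_mul_I]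
    congr 1
    push_cast
    ring
  have x₄ : Complex.exp ((-(4 * π / 5) : ℝ) * Complex.I) =
      -Complex.exp ((π / 5 : ℝ) * Complex.I) := by
    rw [← Complex.exp_sub_pi_mul_I]
    congr 1
    push_cast
    ring
  rw [x₃] at e₃
  rw [x₄] at e₄
  have hP : ptP = L₄ * Complex.exp ((π / 5 : ℝ) * Complex.I) := by linear_combination -e₄
  have hB : develop b = ((L₃ + L₄ : ℝ) : ℂ) * Complex.exp ((π / 5 : ℝ) * Complex.I) := by
    rw [Complex.ofReal_add]
    linear_combination -e₃ - e₄
  have key := e₂.symm.trans hB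
  have kre := congrArg Complex.re key
  have kim := congrArg Complex.im key
  simp only [Complex.add_re, Complex.add_im, Complex.re_ofReal_mul, Complex.im_ofReal_mul,
    Complex.exp_ofReal_mul_I_re, Complex.exp_ofReal_mul_I_im, Complex.ofReal_re,
    Complex.ofReal_im, zero_add] at kre kim
  have s₁ : Real.sin (3 * π / 10) = Real.cos (π / 5) := by
    rw [← Real.cos_pi_div_two_sub]
    congr 1
    ring
  -- This is `sin (π/10) = cos (2π/5)`, the sine of the angle at `B`.
  have s₂ : Real.sin (3 * π / 10) * Real.cos (π / 5) - Real.cos (3 * π / 10) * Real.sin (π / 5)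
      = a / 2 := by
    rw [← Real.sin_sub, a, ← Real.cos_pi_div_two_sub, mul_div_cancel_left₀ _ two_ne_zero]
    congr 1
    ring
  have hLb : L₃ + L₄ = b := by
    have h1 : (L₃ + L₄) * (a / 2) = b * (a / 2) := by
      rw [← s₂, b]
      have h2 : (L₃ + L₄) * (Real.sin (3 * π / 10) * Real.cos (π / 5) -
          Real.cos (3 * π / 10) * Real.sin (π / 5)) = a * Real.sin (3 * π / 10) := by
        linear_combination -Real.sin (3 * π / 10) * kre + Real.cos (3 * π / 10) * kim
      rw [h2, s₂, s₁]
      ring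
    exact mul_right_cancel₀ (by linarith [a_pos] : a / 2 ≠ 0) h1
  refine ⟨by rw [hB, hLb, ptB], L₄ / b, div_pos h₄ b_pos, ?_, ?_⟩
  · rw [div_lt_one b_pos]
    linarith
  · have : (b : ℂ) ≠ 0 := by exact_mod_cast b_pos.ne'
    rw [hP, ptB]
    push_cast
    field_simp

/-! ### The triangle in affine coordinates -/

/-- The coordinate along `OB`. -/
def coordB : ℂ →L[ℝ] ℝ := (b * Real.sin (π / 5))⁻¹ • Complex.imCLM

/-- The coordinate along `OA`. -/
def coordA : ℂ →L[ℝ] ℝ :=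
  a⁻¹ • (Complex.reCLM - (Real.cos (π / 5) / Real.sin (π / 5)) • Complex.imCLM)

theorem ptB_re : ptB.re = b * Real.cos (π / 5) := by
  rw [ptB, Complex.re_ofReal_mul, Complex.exp_ofReal_mul_I_re]

theorem ptB_im : ptB.im = b * Real.sin (π / 5) := by
  rw [ptB, Complex.im_ofReal_mul, Complex.exp_ofReal_mul_I_im]

theorem coordA_ptA : coordA ptA = 1 := by
  have := a_pos.ne'
  simp [coordA, ptA, this]

theorem coordB_ptA : coordB ptA = 0 := by
  simp [coordB, ptA]

theorem coordA_ptB : coordA ptB = 0 := by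
  have := sin_pi_div_five_pos.ne'
  simp only [coordA, smul_apply, sub_apply, Complex.reCLM_apply, Complex.imCLM_apply, ptB_re,
    ptB_im, smul_eq_mul]
  field_simp
  ring

theorem coordB_ptB : coordB ptB = 1 := by
  have := sin_pi_div_five_pos.ne'
  have := b_pos.ne'
  simp only [coordB, smul_apply, Complex.imCLM_apply, ptB_im, smul_eq_mul]
  field_simp

theorem eq_coord (z : ℂ) : z = coordA z • ptA + coordB z • ptB := by
  have := sin_pi_div_five_pos.ne'
  have := b_pos.ne'
  have := a_pos.ne'
  apply Complex.ext
  · simp only [Complex.add_re, Complex.smul_re, ptB_re, ptA, Complex.ofReal_re, smul_eq_mul,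
      coordA, coordB, smul_apply, sub_apply, Complex.reCLM_apply, Complex.imCLM_apply]
    field_simp
    ring
  · simp only [Complex.add_im, Complex.smul_im, ptB_im, ptA, Complex.ofReal_im, smul_eq_mul,
      coordB, smul_apply, Complex.imCLM_apply]
    field_simp
    ring

theorem eq_iff_coord {z w : ℂ} : z = w ↔ coordA z = coordA w ∧ coordB z = coordB w := by
  refine ⟨fun h => by rw [h]; exact ⟨rfl, rfl⟩, fun h => ?_⟩
  rw [eq_coord z, eq_coord w, h.1, h.2]

theorem mem_T_iff {z : ℂ} : z ∈ T ↔ 0 ≤ coordA z ∧ 0 ≤ coordB z ∧ coordA z + coordB z ≤ 1 := by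
  constructor
  · have hc : Convex ℝ {z | 0 ≤ coordA z ∧ 0 ≤ coordB z ∧ coordA z + coordB z ≤ 1} :=
      (convex_halfSpace_ge coordA.isLinear 0).inter ((convex_halfSpace_ge coordB.isLinear 0).inter
        (convex_halfSpace_le (coordA + coordB).isLinear 1))
    refine fun hz => convexHull_min ?_ hc hz
    rintro _ (rfl | rfl | rfl)
    · simp
    · simp [coordA_ptA, coordB_ptA]
    · simp [coordA_ptB, coordB_ptB]
  · rintro ⟨h1, h2, h3⟩
    have hT : Convex ℝ T := convex_convexHull ℝ _
    have h0 : (0 : ℂ) ∈ T := subset_convexHull ℝ _ (by simp)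
    have hA : ptA ∈ T := subset_convexHull ℝ _ (by simp)
    have hB : ptB ∈ T := subset_convexHull ℝ _ (by simp)
    rw [eq_coord z]
    generalize coordA z = s at *
    generalize coordB z = t at *
    rcases (add_nonneg h1 h2).eq_or_lt with h | h
    · have hs : s = 0 := by linarith
      have ht : t = 0 := by linarith
      simpa [hs, ht] using h0
    · have hm : (s / (s + t)) • ptA + (t / (s + t)) • ptB ∈ T :=
        hT hA hB (by positivity) (by positivity) (by field_simp)
      have := hT.smul_mem_of_zero_mem h0 hm ⟨h.le, h3⟩
      rwa [smul_add, smul_smul, smul_smul, mul_div_cancel₀ _ h.ne', mul_div_cancel₀ _ h.ne'] at this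

theorem isCompact_T : IsCompact T := (toFinite _).isCompact_convexHull ℝ

/-- The open triangle. -/
def Tint : Set ℂ := {z | 0 < coordA z ∧ 0 < coordB z ∧ coordA z + coordB z < 1}

theorem convex_Tint : Convex ℝ Tint :=
  (convex_halfSpace_gt coordA.isLinear 0).inter ((convex_halfSpace_gt coordB.isLinear 0).inter
    (convex_halfSpace_lt (coordA + coordB).isLinear 1))

theorem mem_openSegment_iff_coord {x y z : ℂ} : z ∈ openSegment ℝ x y ↔ ∃ θ ∈ Ioo (0 : ℝ) 1,
    coordA z = coordA x + θ * (coordA y - coordA x) ∧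
    coordB z = coordB x + θ * (coordB y - coordB x) := by
  rw [openSegment_eq_image']
  constructor
  · rintro ⟨θ, hθ, rfl⟩
    exact ⟨θ, hθ, by simp [-Complex.real_smul], by simp [-Complex.real_smul]⟩
  · rintro ⟨θ, hθ, h1, h2⟩
    exact ⟨θ, hθ, eq_iff_coord.2
      ⟨by simp [-Complex.real_smul, h1], by simp [-Complex.real_smul, h2]⟩⟩

/-- A nonzero linear functional has no local minimum. -/
theorem lt_of_eventually_le {u : ℂ →L[ℝ] ℝ} (hu : u ≠ 0) {q : ℂ} {c : ℝ}
    (h : ∀ᶠ z in 𝓝 q, c ≤ u z) : c < u q := by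
  refine lt_of_le_of_ne h.self_of_nhds fun hc => hu ?_
  have hmin : IsLocalMin u q := by
    filter_upwards [h] with z hz
    rwa [← hc]
  have := hmin.fderiv_eq_zero
  rwa [u.fderiv] at this

/-- A compact set each of whose points either is interior or belongs to the compact convex set `C`
is contained in `C`. -/
theorem subset_of_forall_mem_or_mem_nhds {K C : Set ℂ} (hK : IsCompact K) (hC : IsClosed C)
    (hconv : Convex ℝ C) (hne : C.Nonempty) (h : ∀ q ∈ K, q ∈ C ∨ K ∈ 𝓝 q) : K ⊆ C := by
  intro z hz
  by_contra hzC
  obtain ⟨u, c, hu, hc⟩ := geometric_hahn_banach_closed_point hconv hC hzC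
  -- A maximum point on `K` of the separating functional lies outside `C`, and it cannot be interior
  -- to `K` either.
  obtain ⟨q, hq, hmax⟩ := hK.exists_isMaxOn ⟨z, hz⟩ u.continuous.continuousOn
  have hcq : c < u q := hc.trans_le (hmax hz)
  rcases h q hq with hqC | hqK
  · exact (hu q hqC).not_gt hcq
  · obtain ⟨w, hw⟩ := hne
    have hu0 : -u ≠ 0 := by
      rintro h0
      have := (hu w hw).trans hc
      rw [neg_eq_zero.1 h0] at this
      simp at this
    have := lt_of_eventually_le hu0 (q := q) (c := -u q) (by
      filter_upwards [hqK] with y hy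
      have : u y ≤ u q := hmax hy
      simpa using this)
    simp at this

theorem coordA_ne_zero : coordA ≠ 0 := fun h => by
  have := coordA_ptA
  rw [h] at this
  simp at this

theorem coordB_ne_zero : coordB ≠ 0 := fun h => by
  have := coordB_ptB
  rw [h] at this
  simp at this

theorem mem_Tint_of_T_mem_nhds {q : ℂ} (h : T ∈ 𝓝 q) : q ∈ Tint := by
  have hAB : -(coordA + coordB) ≠ 0 := fun h => by
    have : (-(coordA + coordB)) ptA = 0 := by rw [h]; rfl
    simp [coordA_ptA, coordB_ptA] at this
  refine ⟨lt_of_eventually_le coordA_ne_zero ?_, lt_of_eventually_le coordB_ne_zero ?_, ?_⟩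
  · filter_upwards [h] with z hz using (mem_T_iff.1 hz).1
  · filter_upwards [h] with z hz using (mem_T_iff.1 hz).2.1
  · have := lt_of_eventually_le hAB (q := q) (c := -1) (by
      filter_upwards [h] with z hz
      have := (mem_T_iff.1 hz).2.2
      simp only [neg_apply, add_apply]
      linarith)
    simp only [neg_apply, add_apply] at this
    linarith

/-! ### The image of the Schwarz-Christoffel map -/

theorem develop_ptB : develop b = ptB := develop_b_and_ptP.1

theorem exists_coord_ptP : ∃ x : ℝ, 0 < x ∧ x < 1 ∧ coordA ptP = 0 ∧ coordB ptP = x := by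
  obtain ⟨-, x, h0, h1, h⟩ := develop_b_and_ptP
  have h' : ptP = x • ptB := by rw [h, Complex.real_smul]
  refine ⟨x, h0, h1, ?_, ?_⟩
  · rw [h', map_smul, coordA_ptB, smul_zero]
  · rw [h', map_smul, coordB_ptB, smul_eq_mul, mul_one]

theorem ptP_mem_openSegment : ptP ∈ openSegment ℝ 0 ptB := by
  obtain ⟨x, h0, h1, hA, hB⟩ := exists_coord_ptP
  exact mem_openSegment_iff_coord.2 ⟨x, ⟨h0, h1⟩, by simp [hA, coordA_ptB], by simp [hB, coordB_ptB]⟩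

/-- The four parts of the punctured real axis are mapped onto the boundary of the triangle without
the vertices and the point `P`. -/
theorem mem_develop_image_real_iff {z : ℂ} :
    (∃ x : ℝ, f x ≠ 0 ∧ develop x = z) ↔ z ∈ Tstar \ {ptP} ∧ z ∉ Tint := by
  obtain ⟨p, hp0, hp1, hPA, hPB⟩ := exists_coord_ptP
  have hsplit : (∃ x : ℝ, f x ≠ 0 ∧ develop x = z) ↔
      z ∈ openSegment ℝ ptP 0 ∨ z ∈ openSegment ℝ 0 ptA ∨ z ∈ openSegment ℝ ptA ptB ∨
        z ∈ openSegment ℝ ptB ptP := by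
    have e1 := develop_image_Iio_zero.2
    have e2 := develop_image_Ioo_zero_a
    have e3 := develop_image_Ioo_a_b.2
    have e4 := develop_image_Ioi_b.2
    rw [develop_ptB] at e3 e4
    rw [ptA, ← e1, ← e2, ← e3, ← e4]
    have hf : ∀ x : ℝ, f x ≠ 0 ↔ x ≠ 0 ∧ x ≠ a ∧ x ≠ b := by
      intro x
      rw [Ne, f_eq_zero_iff]
      simp
    constructor
    · rintro ⟨x, hx, rfl⟩
      obtain ⟨h0, h1, h2⟩ := (hf x).1 hx
      rcases lt_or_gt_of_ne h0 with h0 | h0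
      · exact Or.inl ⟨x, h0, rfl⟩
      rcases lt_or_gt_of_ne h1 with h1 | h1
      · exact Or.inr (Or.inl ⟨x, ⟨h0, h1⟩, rfl⟩)
      rcases lt_or_gt_of_ne h2 with h2 | h2
      · exact Or.inr (Or.inr (Or.inl ⟨x, ⟨h1, h2⟩, rfl⟩))
      · exact Or.inr (Or.inr (Or.inr ⟨x, h2, rfl⟩))
    · have ha := a_pos
      have hab := a_lt_b
      rintro (⟨x, hx, rfl⟩ | ⟨x, hx, rfl⟩ | ⟨x, hx, rfl⟩ | ⟨x, hx, rfl⟩) <;>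
        refine ⟨x, (hf x).2 ?_, rfl⟩ <;>
        simp only [mem_Iio, mem_Ioi, mem_Ioo] at hx <;>
        refine ⟨?_, ?_, ?_⟩ <;> rintro rfl <;> linarith
  rw [hsplit]
  simp only [mem_openSegment_iff_coord, Tstar, Set.mem_sdiff, mem_insert_iff, mem_singleton_iff,
    eq_iff_coord (z := z), mem_T_iff, Tint, mem_ofPred_eq, hPA, hPB, coordA_ptA, coordA_ptB,
    coordB_ptA, coordB_ptB, map_zero]
  generalize coordA z = s
  generalize coordB z = t
  constructor
  · rintro (⟨θ, ⟨h0, h1⟩, rfl, rfl⟩ | ⟨θ, ⟨h0, h1⟩, rfl, rfl⟩ | ⟨θ, ⟨h0, h1⟩, rfl, rfl⟩ |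
      ⟨θ, ⟨h0, h1⟩, rfl, rfl⟩)
    · have h2 : 0 < p * (1 - θ) := mul_pos hp0 (by linarith)
      have h3 : 0 < p * θ := mul_pos hp0 h0
      refine ⟨⟨⟨⟨by simp, by linarith, by linarith⟩, ?_⟩, ?_⟩, ?_⟩
      · rintro (⟨h, h'⟩ | ⟨h, h'⟩ | ⟨h, h'⟩) <;> linarith
      · rintro ⟨h, h'⟩; linarith
      · rintro ⟨h, h'⟩; linarith
    · refine ⟨⟨⟨⟨by linarith, by simp, by linarith⟩, ?_⟩, ?_⟩, ?_⟩
      · rintro (⟨h, h'⟩ | ⟨h, h'⟩ | ⟨h, h'⟩) <;> linarith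
      · rintro ⟨h, h'⟩; linarith
      · rintro ⟨h, h', h''⟩; linarith
    · refine ⟨⟨⟨⟨by linarith, by linarith, by linarith⟩, ?_⟩, ?_⟩, ?_⟩
      · rintro (⟨h, h'⟩ | ⟨h, h'⟩ | ⟨h, h'⟩) <;> linarith
      · rintro ⟨h, h'⟩; linarith
      · rintro ⟨h, h', h''⟩; linarith
    · have h2 : 0 < (1 - p) * (1 - θ) := mul_pos (by linarith) (by linarith)
      have h3 : 0 < (1 - p) * θ := mul_pos (by linarith) h0
      refine ⟨⟨⟨⟨by simp, by linarith, by linarith⟩, ?_⟩, ?_⟩, ?_⟩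
      · rintro (⟨h, h'⟩ | ⟨h, h'⟩ | ⟨h, h'⟩) <;> linarith
      · rintro ⟨h, h'⟩; linarith
      · rintro ⟨h, h'⟩; linarith
  · rintro ⟨⟨⟨⟨h1, h2, h3⟩, hv⟩, hP⟩, hint⟩
    -- The side `OB` is covered in two pieces, by the negative axis below `P` and by `(b, ∞)` above
    -- it.
    rcases h1.eq_or_lt with rfl | h1
    · have ht0 : 0 < t := lt_of_le_of_ne h2 fun h => hv (Or.inl ⟨rfl, h.symm⟩)
      have ht1 : t < 1 := lt_of_le_of_ne (by linarith) fun h => hv (Or.inr (Or.inr ⟨rfl, h⟩))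
      rcases lt_or_gt_of_ne (fun h => hP ⟨rfl, h⟩ : t ≠ p) with h | h
      · refine Or.inl ⟨(p - t) / p, ⟨div_pos (by linarith) hp0, ?_⟩, by simp, ?_⟩
        · rw [div_lt_one hp0]; linarith
        · field_simp
          ring
      · have hp' : 0 < 1 - p := by linarith
        refine Or.inr (Or.inr (Or.inr ⟨(1 - t) / (1 - p), ⟨div_pos (by linarith) hp', ?_⟩,
          by simp, ?_⟩))
        · rw [div_lt_one hp']; linarith
        · field_simp
          ring
    rcases h2.eq_or_lt with rfl | h2
    · have hs1 : s < 1 := lt_of_le_of_ne (by linarith) fun h => hv (Or.inr (Or.inl ⟨h, rfl⟩))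
      exact Or.inr (Or.inl ⟨s, ⟨h1, hs1⟩, by simp, by simp⟩)
    · have h4 : s + t = 1 := le_antisymm h3 (not_lt.1 fun h => hint ⟨h1, h2, h⟩)
      exact Or.inr (Or.inr (Or.inl ⟨t, ⟨h2, by linarith⟩, by linarith, by linarith⟩))

/-- The open upper half plane is mapped onto the open triangle. -/
theorem develop_image_halfPlane : develop '' {z | 0 < z.im} = Tint := by
  set H : Set ℂ := {z | 0 < z.im}
  have hHo : IsOpen H := isOpen_lt continuous_const Complex.continuous_im
  -- Adding the value at infinity makes the image of the closed half plane compact.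
  set K : Set ℂ := insert ptP (develop '' upper)
  have hclosed : IsClosed upper := isClosed_le continuous_const Complex.continuous_im
  have hK : IsCompact K := by
    have hr : range (upper.domRestrict develop) = develop '' upper := range_domRestrict _ _
    rw [show K = insert ptP (range (upper.domRestrict develop)) by rw [hr]]
    refine Tendsto.isCompact_insert_range_of_cocompact ?_ continuousOn_develop.domRestrict
    refine tendsto_develop.comp (f := ((↑) : upper → ℂ)) (tendsto_inf.2 ⟨?_, ?_⟩)
    · rw [Metric.cobounded_eq_cocompact]
      exact hclosed.isClosedEmbedding_subtypeVal.tendsto_cocompact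
    · exact tendsto_principal.2 (Eventually.of_forall fun z => z.2)
  have hHK : develop '' H ⊆ K :=
    (image_mono fun z hz => show (0 : ℝ) ≤ z.im from le_of_lt hz).trans (subset_insert _ _)
  -- The derivative does not vanish on the open half plane, so the map is open there.
  have hnhds : ∀ q ∈ develop '' H, develop '' H ∈ 𝓝 q := by
    rintro _ ⟨ξ, hξ, rfl⟩
    have hd := isDetermination_develop.hasStrictDerivAt (z := ξ) (Or.inl hξ)
    rw [← hd.map_nhds_eq (isDetermination_develop.deriv_ne_zero k_pos.ne' (Or.inl hξ))]
    exact image_mem_map (hHo.mem_nhds hξ)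
  have hbd : ∀ q ∈ K, (q ∈ T ∧ q ∉ Tint) ∨ q ∈ develop '' H := by
    rintro q (rfl | ⟨ξ, hξ, rfl⟩)
    · obtain ⟨x, h0, h1, hA, hB⟩ := exists_coord_ptP
      refine Or.inl ⟨mem_T_iff.2 ⟨by rw [hA], by rw [hB]; exact h0.le, by rw [hA, hB]; linarith⟩,
        fun h => ?_⟩
      have := h.1
      rw [hA] at this
      exact this.false
    · rcases (show 0 ≤ ξ.im from hξ).eq_or_lt with h | h
      · left
        obtain ⟨x, rfl⟩ : ∃ x : ℝ, (x : ℂ) = ξ := ⟨ξ.re, Complex.ext rfl h⟩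
        by_cases hf : f x = 0
        · rcases f_eq_zero_iff.1 hf with h | h | h
          · rw [h, develop_zero]
            exact ⟨mem_T_iff.2 (by simp), fun h => by simpa using h.1⟩
          · rw [h, develop_a]
            refine ⟨mem_T_iff.2 ?_, fun h => ?_⟩
            · rw [← ptA, coordA_ptA, coordB_ptA]
              norm_num
            · have := h.2.1
              rw [← ptA, coordB_ptA] at this
              exact this.false
          · rw [h, develop_ptB]
            refine ⟨mem_T_iff.2 ?_, fun h => ?_⟩
            · rw [coordA_ptB, coordB_ptB]
              norm_num
            · have := h.1
              rw [coordA_ptB] at this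
              exact this.false
        · have := mem_develop_image_real_iff.1 ⟨x, hf, rfl⟩
          exact ⟨this.1.1.1, this.2⟩
      · exact Or.inr ⟨ξ, h, rfl⟩
  have hKT : K ⊆ T := by
    refine subset_of_forall_mem_or_mem_nhds hK isCompact_T.isClosed (convex_convexHull ℝ _)
      ⟨0, subset_convexHull ℝ _ (by simp)⟩ fun q hq => ?_
    exact (hbd q hq).imp And.left fun h => mem_of_superset (hnhds q h) hHK
  have hsub : develop '' H ⊆ Tint := fun q hq =>
    mem_Tint_of_T_mem_nhds (mem_of_superset (hnhds q hq) (hHK.trans hKT))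
  have hK_of_mem : ∀ q ∈ Tint, q ∈ K → q ∈ develop '' H := fun q hq hqK =>
    (hbd q hqK).resolve_left fun h => h.2 hq
  refine hsub.antisymm fun q hq => hK_of_mem q hq (interior_subset (s := K) ?_)
  -- The boundary values of the map avoid the open triangle, so each of its points is interior to
  -- `K` or outside `K`. Connectedness leaves only the first case, which the image of `i` realises.
  refine convex_Tint.isPreconnected.subset_left_of_subset_union (v := Kᶜ) isOpen_interior
    hK.isClosed.isOpen_compl (disjoint_compl_right.mono_left interior_subset) ?_ ?_ hq
  · intro z hz
    by_cases hzK : z ∈ K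
    · exact Or.inl (mem_interior_iff_mem_nhds.2
        (mem_of_superset (hnhds z (hK_of_mem z hz hzK)) hHK))
    · exact Or.inr hzK
  · have hI : develop Complex.I ∈ develop '' H := mem_image_of_mem _ (by simp [H])
    exact ⟨_, hsub hI, mem_interior_iff_mem_nhds.2 (mem_of_superset (hnhds _ hI) hHK)⟩

theorem develop_image_upper : develop '' {z | z ∈ upper ∧ f z ≠ 0} = Tstar \ {ptP} := by
  ext z
  constructor
  · rintro ⟨ξ, ⟨hξ, hf⟩, rfl⟩
    rcases (show 0 ≤ ξ.im from hξ).eq_or_lt with h | h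
    · obtain ⟨x, rfl⟩ : ∃ x : ℝ, (x : ℂ) = ξ := ⟨ξ.re, Complex.ext rfl h⟩
      exact (mem_develop_image_real_iff.1 ⟨x, hf, rfl⟩).1
    · have hz : develop ξ ∈ Tint := develop_image_halfPlane ▸ mem_image_of_mem develop h
      obtain ⟨h1, h2, h3⟩ := hz
      refine ⟨⟨mem_T_iff.2 ⟨h1.le, h2.le, h3.le⟩, ?_⟩, ?_⟩
      · rintro (h | h | h) <;> rw [h] at h1 h2
        · simp at h1
        · simp [coordB_ptA] at h2
        · simp [coordA_ptB] at h1
      · intro h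
        obtain ⟨x, -, -, hA, -⟩ := exists_coord_ptP
        rw [mem_singleton_iff.1 h, hA] at h1
        exact h1.false
  · intro hz
    by_cases hi : z ∈ Tint
    · rw [← develop_image_halfPlane] at hi
      obtain ⟨ξ, hξ, rfl⟩ := hi
      have hξ' : 0 < ξ.im := hξ
      refine ⟨ξ, ⟨hξ'.le, fun hf => ?_⟩, rfl⟩
      rcases f_eq_zero_iff.1 hf with rfl | rfl | rfl <;> simp at hξ'
    · obtain ⟨x, hf, rfl⟩ := mem_develop_image_real_iff.2 ⟨hz, hi⟩
      exact ⟨x, ⟨ofReal_mem_upper x, hf⟩, rfl⟩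

theorem delta_eq {p : ℂ × ℂ} (hp : p ∈ SregUpper) : delta p = develop p.1 := FT_eq hp.2

theorem lift_mem_Sreg {ξ : ℂ} (hξ : ξ ∈ upper) (hf : f ξ ≠ 0) : (ξ, (integrand ξ)⁻¹) ∈ Sreg := by
  have hs := mem_slitDomain_of_mem_upper hξ hf
  refine mem_Sreg_of_f_ne_zero ?_ hf
  rw [inv_pow]
  exact (eq_inv_of_mul_eq_one_right (integrand_pow_mul hs)).symm

theorem delta_image : delta '' SregUpper = Tstar \ {ptP} := by
  rw [← develop_image_upper]
  ext z
  constructor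
  · rintro ⟨p, hp, rfl⟩
    exact ⟨p.1, ⟨hp.2, f_ne_zero_of_mem_Sreg hp.1⟩, (delta_eq hp).symm⟩
  · rintro ⟨ξ, ⟨hξ, hf⟩, rfl⟩
    have hp : (ξ, (integrand ξ)⁻¹) ∈ SregUpper := ⟨lift_mem_Sreg hξ hf, hξ⟩
    exact ⟨_, hp, delta_eq hp⟩

theorem isBounded_Tstar : Bornology.IsBounded Tstar := isCompact_T.isBounded.subset sdiff_subset

/-! ### The developing map is a local isometry -/

/-- The point may lie on any of the ten sheets, but its `η` differs from the chosen branch by a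
tenth root of unity. Only the modulus of `k/η` enters `Γ`. -/
theorem exists_hasFDerivWithinAt_delta {p : ℂ × ℂ} (hp : p ∈ SregUpper) :
    ∃ L : ℂ × ℂ →L[ℂ] ℂ, HasFDerivWithinAt delta L SregUpper p ∧
      ∀ v w : ℂ × ℂ, (p, v) ∈ TSreg → (p, w) ∈ TSreg → Gam p v w = ⟪L v, L w⟫_ℝ := by
  have hs : p.1 ∈ slitDomain := mem_slitDomain_of_mem_upper hp.2 (f_ne_zero_of_mem_Sreg hp.1)
  refine ⟨(k * integrand p.1) • ContinuousLinearMap.fst ℂ ℂ ℂ, ?_, fun v w _ _ => ?_⟩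
  · have h := (hasDerivAt_develop hs).comp_hasFDerivAt p
      (hasFDerivAt_fst (𝕜 := ℂ) (p := p))
    exact h.hasFDerivWithinAt.congr (fun q hq => delta_eq hq) (delta_eq hp)
  · have hin : ∀ m x y : ℂ, ⟪m * x, m * y⟫_ℝ = ‖m‖ ^ 2 * ⟪x, y⟫_ℝ := by
      intro m x y
      rw [← Complex.normSq_eq_norm_sq]
      simp only [Complex.inner, Complex.normSq_apply, Complex.mul_re, Complex.mul_im,
        Complex.conj_re, Complex.conj_im]
      ring
    have hp10 : p.2 ^ 10 = f p.1 := hp.1.1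
    have e : ‖(k : ℂ) / p.2‖ = ‖(k : ℂ) * integrand p.1‖ := by
      refine (pow_left_inj₀ (norm_nonneg _) (norm_nonneg _) (show 10 ≠ 0 by norm_num)).1 ?_
      rw [← norm_pow, ← norm_pow, div_pow, hp10, mul_pow,
        eq_inv_of_mul_eq_one_left (integrand_pow_mul hs), div_eq_mul_inv]
    simp only [Gam, smul_apply, ContinuousLinearMap.coe_fst', smul_eq_mul, hin, e]

/-! ### Uniqueness of geodesics -/

theorem isGeodesicOn_of_isIntegralCurveIn {y : ℝ → (ℂ × ℂ) × (ℂ × ℂ)} {J : Set ℝ} (hJ : IsOpen J)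
    (hy : IsIntegralCurveIn geodesicField TSreg y J) :
    IsGeodesicOn (fun t => (y t).1) J ∧ ∀ t ∈ J, y t = ((y t).1, deriv (fun t => (y t).1) t) := by
  have h : ∀ t ∈ J, y t = ((y t).1, deriv (fun t => (y t).1) t) := by
    intro t ht
    have := ((hy.1 t ht).hasDerivAt (hJ.mem_nhds ht)).hasFDerivAt.fst.hasDerivAt
    have h2 : deriv (fun t => (y t).1) t = (y t).2 := by
      rw [this.deriv]
      simp [geodesicField]
    rw [h2]
  refine ⟨⟨fun t ht => ?_, fun t ht => ?_⟩, h⟩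
  · have h1 := (hy.1 t ht).congr (fun s hs => (h s hs).symm) (h t ht).symm
    exact h1.congr_deriv (congrArg geodesicField (h t ht))
  · have h1 := hy.2 t ht
    rw [h t ht] at h1
    exact h1

/-- Initial position and velocity fix both the segment `D ∘ ξ` and the constant `D'(ξ) η`. Local
injectivity of `D` recovers `ξ`, and then `η`. -/
theorem IsDetermination.eventuallyEq_of_isGeodesicOn {V : Set ℂ} {D : ℂ → ℂ}
    (hD : IsDetermination V D) (hk : k ≠ 0) {c c' : ℝ → ℂ × ℂ} {J : Set ℝ} (hJ : IsOpen J)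
    (hc : IsGeodesicOn c J) (hc' : IsGeodesicOn c' J) {t₀ : ℝ} (h₀ : t₀ ∈ J)
    (hV : (c t₀).1 ∈ V) (heq : c t₀ = c' t₀) (hder : deriv c t₀ = deriv c' t₀) :
    c =ᶠ[𝓝 t₀] c' := by
  have hcont : ∀ {γ : ℝ → ℂ × ℂ}, IsGeodesicOn γ J → ∀ t ∈ J, ContinuousAt γ t :=
    fun h t ht => (h.hasDerivAt hJ ht).continuousAt
  have hVe : ∀ {γ : ℝ → ℂ × ℂ}, IsGeodesicOn γ J → (γ t₀).1 ∈ V → ∀ᶠ t in 𝓝 t₀, (γ t).1 ∈ V :=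
    fun h hV => (continuousAt_fst.comp (hcont h t₀ h₀)).eventually (hD.isOpen.mem_nhds hV)
  obtain ⟨ε, hε, hball⟩ := Metric.eventually_nhds_iff_ball.1
    ((hJ.eventually_mem h₀).and ((hVe hc hV).and (hVe hc' (heq ▸ hV))))
  rw [Real.ball_eq_Ioo] at hball
  set I := Ioo (t₀ - ε) (t₀ + ε)
  have hI₀ : t₀ ∈ I := ⟨by linarith, by linarith⟩
  have hIJ : I ⊆ J := fun t ht => (hball t ht).1
  have hIo : IsOpen I := isOpen_Ioo
  have hrestrict : ∀ {γ : ℝ → ℂ × ℂ}, IsGeodesicOn γ J → IsGeodesicOn γ I := fun h =>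
    ⟨fun t ht => (h.1 t (hIJ ht)).mono hIJ, fun t ht => h.2 t (hIJ ht)⟩
  have hs : ∀ {γ : ℝ → ℂ × ℂ}, IsGeodesicOn γ J → (∀ t ∈ I, (γ t).1 ∈ V) →
      ∀ t ∈ I, D (γ t).1 = D (γ t₀).1 + ((t - t₀ : ℝ) : ℂ) * (deriv D (γ t₀).1 * (deriv γ t₀).1) := by
    intro γ hγ hγV
    obtain ⟨z, α, hα⟩ := hD.isStraightOn hk hIo ordConnected_Ioo hγV (hrestrict hγ)
    have d1 : HasDerivAt (fun s => D (γ s).1) (deriv D (γ t₀).1 * (deriv γ t₀).1) t₀ := by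
      refine (hD.hasStrictDerivAt (hγV t₀ hI₀)).hasDerivAt.comp_of_eq t₀ ?_ rfl
      exact (hγ.hasDerivAt hJ h₀).hasFDerivAt.fst.hasDerivAt.congr_deriv (by simp)
    have d2 : HasDerivAt (fun s : ℝ => z + (s : ℂ) * α) α t₀ := by
      refine (((Complex.ofRealCLM.hasDerivAt (x := t₀)).mul_const α).const_add z).congr_deriv ?_
      simp
    have d3 := d2.congr_of_eventuallyEq (f₁ := fun s => D (γ s).1) (by
      filter_upwards [hIo.mem_nhds hI₀] with s hs using hα s hs)
    intro t ht
    have e1 : D (γ t).1 = z + t * α := hα t ht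
    have e2 : D (γ t₀).1 = z + t₀ * α := hα t₀ hI₀
    rw [d1.unique d3, e1, e2]
    push_cast
    ring
  have hw : ∀ {γ : ℝ → ℂ × ℂ}, IsGeodesicOn γ J → (∀ t ∈ I, (γ t).1 ∈ V) →
      ∀ t ∈ I, deriv D (γ t).1 * (γ t).2 = deriv D (γ t₀).1 * (γ t₀).2 := by
    intro γ hγ hγV t ht
    obtain ⟨w, hw⟩ := hD.exists_deriv_mul_eq (J := I) ordConnected_Ioo
      (fun t ht => (hcont hγ t (hIJ ht)).continuousWithinAt)
      fun t ht => ⟨(hγ.2 t (hIJ ht)).1, hγV t ht⟩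
    rw [hw t ht, hw t₀ hI₀]
  have hV₁ : ∀ t ∈ I, (c t).1 ∈ V := fun t ht => (hball t ht).2.1
  have hV₂ : ∀ t ∈ I, (c' t).1 ∈ V := fun t ht => (hball t ht).2.2
  have hinv := ((hD.hasStrictDerivAt hV).hasStrictFDerivAt_equiv
    (hD.deriv_ne_zero hk hV)).eventually_left_inverse
  have hinv₁ := (continuousAt_fst.comp (hcont hc t₀ h₀)).eventually hinv
  have hinv₂ := (continuousAt_fst.comp (hcont hc' t₀ h₀)).eventually
    (show _ ∈ 𝓝 (c' t₀).1 by rw [← heq]; exact hinv)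
  filter_upwards [hinv₁, hinv₂, hIo.mem_nhds hI₀] with t h1 h2 ht
  have hDt : D (c t).1 = D (c' t).1 := by
    rw [hs hc hV₁ t ht, hs hc' hV₂ t ht, heq, hder]
  have hξ : (c t).1 = (c' t).1 := by
    simp only [Function.comp] at h1 h2
    rw [← h1, hDt, h2]
  refine Prod.ext hξ ?_
  have e := hw hc hV₁ t ht
  rw [heq, ← hw hc' hV₂ t ht, ← hξ] at e
  exact mul_left_cancel₀ (hD.deriv_ne_zero hk (hV₁ t ht)) e

/-- The set of times near which both curves agree is open by definition, and relatively closed by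
continuity and local uniqueness. -/
theorem IsDetermination.eqOn_of_isIntegralCurveIn {V : Set ℂ} {D : ℂ → ℂ}
    (hD : IsDetermination V D) (hk : k ≠ 0) {x y : ℝ → (ℂ × ℂ) × (ℂ × ℂ)} {J : Set ℝ}
    (hJ : IsOpen J) (hJc : J.OrdConnected) {t₀ : ℝ} (h₀ : t₀ ∈ J)
    (hx : IsIntegralCurveIn geodesicField TSreg x J)
    (hy : IsIntegralCurveIn geodesicField TSreg y J) (hV : ∀ t ∈ J, (x t).1.1 ∈ V)
    (heq : x t₀ = y t₀) : EqOn x y J := by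
  obtain ⟨gx, ex⟩ := isGeodesicOn_of_isIntegralCurveIn hJ hx
  obtain ⟨gy, ey⟩ := isGeodesicOn_of_isIntegralCurveIn hJ hy
  have hloc : ∀ t ∈ J, x t = y t → x =ᶠ[𝓝 t] y := by
    intro t ht h
    have hd : deriv (fun t => (x t).1) t = deriv (fun t => (y t).1) t := by
      have := h
      rw [ex t ht, ey t ht] at this
      exact (Prod.ext_iff.1 this).2
    have he := hD.eventuallyEq_of_isGeodesicOn hk hJ gx gy ht (hV t ht) (by simp only [h]) hd
    filter_upwards [he, he.deriv, hJ.mem_nhds ht] with s hs hs' hsJ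
    rw [ex s hsJ, ey s hsJ, hs']
    exact Prod.ext hs rfl
  have hcont : ∀ {z : ℝ → (ℂ × ℂ) × (ℂ × ℂ)}, IsIntegralCurveIn geodesicField TSreg z J →
      ∀ t ∈ J, ContinuousAt z t := fun h t ht =>
    ((h.1 t ht).hasDerivAt (hJ.mem_nhds ht)).continuousAt
  have hsub : J ⊆ {t | ∀ᶠ s in 𝓝 t, x s = y s} := by
    refine hJc.isPreconnected.subset_of_closure_inter_subset isOpen_setOfPred_eventually_nhds
      ⟨t₀, h₀, hloc t₀ h₀ heq⟩ ?_
    rintro t ⟨htc, ht⟩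
    refine hloc t ht ?_
    by_contra hne
    have hev : ∀ᶠ s in 𝓝 t, x s ≠ y s :=
      ((hcont hx t ht).tendsto.prodMk_nhds (hcont hy t ht).tendsto).eventually
        (isClosed_diagonal.isOpen_compl.mem_nhds hne)
    obtain ⟨s, hs, hs'⟩ := ((mem_closure_iff_frequently.1 htc).and_eventually hev).exists
    exact hs' (Eventually.self_of_nhds (p := fun s => x s = y s) hs)
  exact fun t ht => Eventually.self_of_nhds (p := fun s => x s = y s) (hsub ht)

/-! ### A geodesic that runs into two vertices -/

theorem mem_openSegment_ofReal {z : ℂ} :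
    z ∈ openSegment ℝ 0 (a : ℂ) ↔ ∃ r : ℝ, 0 < r ∧ r < a ∧ z = r := by
  rw [openSegment_eq_image']
  constructor
  · rintro ⟨θ, ⟨h0, h1⟩, rfl⟩
    refine ⟨θ * a, mul_pos h0 a_pos, by nlinarith [a_pos], by simp⟩
  · rintro ⟨r, h0, h1, rfl⟩
    refine ⟨r / a, ⟨div_pos h0 a_pos, (div_lt_one a_pos).2 h1⟩, ?_⟩
    have : (a : ℂ) ≠ 0 := by exact_mod_cast a_pos.ne'
    simp only [zero_add, sub_zero, Complex.real_smul]
    push_cast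
    field_simp

theorem exists_develop_eq_ofReal {x : ℝ} (hx : x ∈ Ioo 0 a) :
    ∃ r : ℝ, 0 < r ∧ r < a ∧ develop x = r := by
  rw [← mem_openSegment_ofReal, ← develop_image_Ioo_zero_a]
  exact mem_image_of_mem (fun x : ℝ => develop x) hx

theorem strictMonoOn_develop_re : StrictMonoOn (fun x : ℝ => (develop x).re) (Ioo 0 a) := by
  have hd : ∀ x ∈ Ioo 0 a, HasDerivAt (fun x : ℝ => (develop x).re) (k * ‖integrand x‖) x := by
    intro x hx
    have h := hasDerivAt_primitive_ofReal (θ := 0) hx.1.ne' hx.2.ne (hx.2.trans a_lt_b).ne (by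
      rw [Real.sign_of_pos hx.1, Real.sign_of_neg (sub_neg.2 hx.2),
        Real.sign_of_neg (sub_neg.2 (hx.2.trans a_lt_b))]
      ring) k
    exact (Complex.reCLM.hasFDerivAt.comp_hasDerivAt x h).congr_deriv (by simp)
  refine strictMonoOn_of_deriv_pos (convex_Ioo _ _)
    (fun x hx => (hd x hx).continuousAt.continuousWithinAt) fun x hx => ?_
  rw [interior_Ioo] at hx
  rw [(hd x hx).deriv]
  exact mul_pos k_pos (norm_integrand_ofReal_pos hx.1.ne' hx.2.ne (hx.2.trans a_lt_b).ne)

theorem f_ofReal_ne_zero {x : ℝ} (hx : x ∈ Ioo 0 a) : f x ≠ 0 := by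
  rw [Ne, f_eq_zero_iff]
  have := a_lt_b
  rintro (h | h | h) <;> norm_cast at h <;> linarith [hx.1, hx.2]

/-- The geodesic of `S_reg` that is developed onto the open edge `OA` with unit speed. -/
theorem exists_edge_geodesic : ∃ ξ : ℝ → ℝ,
    (∀ t ∈ Ioo (-(a / 2)) (a / 2), ξ t ∈ Ioo 0 a ∧ develop (ξ t) = ((a / 2 + t : ℝ) : ℂ)) ∧
    IsGeodesicOn (fun t => ((ξ t : ℂ), (integrand (ξ t))⁻¹)) (Ioo (-(a / 2)) (a / 2)) := by
  have hex : ∀ t : ℝ, ∃ x : ℝ, t ∈ Ioo (-(a / 2)) (a / 2) →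
      x ∈ Ioo 0 a ∧ develop x = ((a / 2 + t : ℝ) : ℂ) := by
    intro t
    by_cases ht : t ∈ Ioo (-(a / 2)) (a / 2)
    · have : ((a / 2 + t : ℝ) : ℂ) ∈ (fun x : ℝ => develop x) '' Ioo 0 a := by
        rw [develop_image_Ioo_zero_a, mem_openSegment_ofReal]
        exact ⟨_, by linarith [ht.1], by linarith [ht.2], rfl⟩
      obtain ⟨x, hx, h⟩ := this
      exact ⟨x, fun _ => ⟨hx, h⟩⟩
    · exact ⟨0, fun h => absurd h ht⟩
  choose ξ hξ using hex
  have hmono : MonotoneOn ξ (Ioo (-(a / 2)) (a / 2)) := by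
    intro s hs t ht hst
    by_contra! h
    have := strictMonoOn_develop_re (hξ t ht).1 (hξ s hs).1 h
    simp only [(hξ t ht).2, (hξ s hs).2, Complex.ofReal_re] at this
    linarith
  have himage : Ioo 0 a ⊆ ξ '' Ioo (-(a / 2)) (a / 2) := by
    intro x hx
    obtain ⟨r, h0, h1, hr⟩ := exists_develop_eq_ofReal hx
    have ht : r - a / 2 ∈ Ioo (-(a / 2)) (a / 2) := ⟨by linarith, by linarith⟩
    refine ⟨r - a / 2, ht, strictMonoOn_develop_re.injOn (hξ _ ht).1 hx ?_⟩
    simp only [(hξ _ ht).2, hr, Complex.ofReal_re]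
    ring
  -- A monotone function whose image contains a neighbourhood of each value has no jumps.
  have hcont : ContinuousOn ξ (Ioo (-(a / 2)) (a / 2)) := fun t ht =>
    (continuousAt_of_monotoneOn_of_image_mem_nhds hmono (isOpen_Ioo.mem_nhds ht)
      (mem_of_superset (isOpen_Ioo.mem_nhds (hξ t ht).1) himage)).continuousWithinAt
  have hslit : ∀ t ∈ Ioo (-(a / 2)) (a / 2), (ξ t : ℂ) ∈ slitDomain := fun t ht =>
    mem_slitDomain_of_mem_upper (ofReal_mem_upper _) (f_ofReal_ne_zero (hξ t ht).1)
  have hcont' : ContinuousOn (fun t => (ξ t : ℂ)) (Ioo (-(a / 2)) (a / 2)) :=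
    Complex.continuous_ofReal.comp_continuousOn hcont
  refine ⟨ξ, hξ, isDetermination_develop.isGeodesicOn k_pos.ne' isOpen_Ioo ordConnected_Ioo
    (hcont'.prodMk ((continuousOn_integrand.comp hcont' hslit).inv₀
      fun t ht => integrand_ne_zero (hslit t ht)))
    (fun t ht => ⟨lift_mem_Sreg (ofReal_mem_upper _) (f_ofReal_ne_zero (hξ t ht).1), hslit t ht⟩)
    ⟨((a / 2 : ℝ) : ℂ), 1, fun t ht => ?_⟩⟩
  simp only [(hξ t ht).2]
  push_cast
  ring

theorem isIncomplete_geodesicField : IsIncomplete geodesicField TSreg := by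
  obtain ⟨ξ, hξ, hgeo⟩ := exists_edge_geodesic
  set c : ℝ → ℂ × ℂ := fun t => ((ξ t : ℂ), (integrand (ξ t))⁻¹)
  set J := Ioo (-(a / 2)) (a / 2)
  have ha := a_pos
  have h0J : (0 : ℝ) ∈ J := ⟨by linarith, by linarith⟩
  refine ⟨fun t => (c t, deriv c t), J, ⟨isOpen_Ioo, ordConnected_Ioo, h0J, hgeo, ?_⟩, ?_⟩
  swap
  · intro h
    have : a / 2 ∈ J := h ▸ mem_univ _
    exact this.2.false
  intro y J' hJ' hJc' h0J' hy h0
  have hN : EqOn (fun t => (c t, deriv c t)) y (J ∩ J') := by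
    refine isDetermination_develop.eqOn_of_isIntegralCurveIn k_pos.ne' (isOpen_Ioo.inter hJ')
      (ordConnected_Ioo.inter hJc') (t₀ := 0) ⟨h0J, h0J'⟩
      ⟨fun t ht => (hgeo.1 t ht.1).mono inter_subset_left, fun t ht => hgeo.2 t ht.1⟩
      ⟨fun t ht => (hy.1 t ht.2).mono inter_subset_right, fun t ht => hy.2 t ht.2⟩
      (fun t ht => ?_) h0.symm
    exact mem_slitDomain_of_mem_upper (ofReal_mem_upper _) (f_ofReal_ne_zero (hξ t ht.1).1)
  -- If a competitor reached an end time `e`, its `ξ`-coordinate there would be a limit of points of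
  -- `(0, a)` and, being regular, would lie in `(0, a)` itself. Its developed value would then be in
  -- the open edge, yet by continuity it equals `a/2 + e`, which is `0` or `a`.
  have hend : ∀ e ∈ J', e ∈ closure J → e = a / 2 ∨ e = -(a / 2) → False := by
    intro e heJ' heJ he
    have hcl : e ∈ closure (J ∩ J') := by
      rw [inter_comm]
      exact hJ'.inter_closure ⟨heJ', heJ⟩
    have : (𝓝[J ∩ J'] e).NeBot := mem_closure_iff_nhdsWithin_neBot.1 hcl
    have hyc : Tendsto (fun t => (y t).1.1) (𝓝[J ∩ J'] e) (𝓝 (y e).1.1) :=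
      (continuous_fst.comp continuous_fst).continuousAt.tendsto.comp
        ((hy.1 e heJ').hasDerivAt (hJ'.mem_nhds heJ')).continuousAt.continuousWithinAt
    have hξt : Tendsto (fun t => (ξ t : ℂ)) (𝓝[J ∩ J'] e) (𝓝 (y e).1.1) := by
      refine hyc.congr' ?_
      filter_upwards [self_mem_nhdsWithin] with t ht
      rw [← hN ht]
    have hq : (y e).1.1 ∈ ((↑) : ℝ → ℂ) '' Icc 0 a := by
      refine (isCompact_Icc.image Complex.continuous_ofReal).isClosed.mem_of_tendsto hξt ?_
      filter_upwards [self_mem_nhdsWithin] with t ht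
      exact mem_image_of_mem _ (Ioo_subset_Icc_self (hξ t ht.1).1)
    obtain ⟨x, hx, hxe⟩ := hq
    have hf := f_ne_zero_of_mem_Sreg (hy.2 e heJ').1
    rw [← hxe] at hf hξt
    have hxI : x ∈ Ioo 0 a := by
      refine ⟨lt_of_le_of_ne hx.1 ?_, lt_of_le_of_ne hx.2 ?_⟩ <;> rintro rfl <;>
        exact hf (by simp [f_eq_zero_iff])
    have hlim : Tendsto (fun t => develop (ξ t)) (𝓝[J ∩ J'] e) (𝓝 (develop x)) :=
      (continuousOn_develop x (ofReal_mem_upper x)).tendsto.comp (tendsto_nhdsWithin_iff.2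
        ⟨hξt, Eventually.of_forall fun t => ofReal_mem_upper _⟩)
    have hlim' : Tendsto (fun t => develop (ξ t)) (𝓝[J ∩ J'] e) (𝓝 ((a / 2 + e : ℝ) : ℂ)) := by
      have : Continuous fun t : ℝ => ((a / 2 + t : ℝ) : ℂ) := by fun_prop
      refine (this.continuousAt (x := e)).continuousWithinAt.tendsto.congr' ?_
      filter_upwards [self_mem_nhdsWithin] with t ht using (hξ t ht.1).2.symm
    obtain ⟨r, hr0, hra, hr⟩ := exists_develop_eq_ofReal hxI
    have heq := hr.symm.trans (tendsto_nhds_unique hlim hlim')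
    norm_cast at heq
    rcases he with rfl | rfl <;> linarith
  have hcJ : closure J = Icc (-(a / 2)) (a / 2) := closure_Ioo (by linarith)
  -- An interval containing `0` that leaves `J` must contain one of its endpoints.
  have hsub : J' ⊆ J := by
    intro t ht
    refine ⟨?_, ?_⟩
    · by_contra! h
      refine hend (-(a / 2)) (hJc'.out ht h0J' ⟨h, by linarith⟩) ?_ (Or.inr rfl)
      rw [hcJ]
      exact ⟨le_rfl, by linarith⟩
    · by_contra! h
      refine hend (a / 2) (hJc'.out h0J' ht ⟨by linarith, h⟩) ?_ (Or.inl rfl)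
      rw [hcJ]
      exact ⟨by linarith, le_rfl⟩
  exact ⟨hsub, fun t ht => (hN ⟨hsub ht, ht⟩).symm⟩

theorem tendsto_FT : Tendsto FT (Bornology.cobounded ℂ ⊓ 𝓟 upper) (𝓝 ptP) := by
  refine tendsto_develop.congr' ?_
  filter_upwards [mem_inf_of_right (mem_principal_self upper)] with ξ hξ using (FT_eq hξ).symm

/-- On the closed half plane without branch points `δ` is the determination `develop` composed with
the projection. Membership in `T*` is automatic by `delta_image`. -/
theorem isGeodesicOn_iff_delta {c : ℝ → ℂ × ℂ} {J : Set ℝ} (hJ : IsOpen J) (hJc : J.OrdConnected)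
    (hc : ContinuousOn c J) (hS : ∀ t ∈ J, c t ∈ SregUpper) :
    IsGeodesicOn c J ↔
      IsStraightOn (fun t => delta (c t)) J ∧ ∀ t ∈ J, delta (c t) ∈ Tstar := by
  have hT : ∀ t ∈ J, delta (c t) ∈ Tstar := fun t ht =>
    (delta_image ▸ mem_image_of_mem delta (hS t ht) : delta (c t) ∈ Tstar \ {ptP}).1
  have hs : IsStraightOn (fun t => delta (c t)) J ↔ IsStraightOn (fun t => develop (c t).1) J := by
    refine exists_congr fun z => exists_congr fun α => forall₂_congr fun t ht => ?_
    simp only [delta_eq (hS t ht)]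
  rw [hs, isDetermination_develop.isGeodesicOn_iff k_pos.ne' hJ hJc hc fun t ht =>
    ⟨(hS t ht).1, mem_slitDomain_of_mem_upper (hS t ht).2 (f_ne_zero_of_mem_Sreg (hS t ht).1)⟩]
  exact ⟨fun h => ⟨h, hT⟩, And.left⟩

end Icosa

end

theorem corollary3 :
    -- the map `δ` is onto `T*`, up to the one boundary point `F_T(∞)`, and `T` is bounded
    (∃ P ∈ openSegment ℝ (0 : ℂ) Icosa.ptB,
        Tendsto Icosa.FT (Bornology.cobounded ℂ ⊓ 𝓟 Icosa.upper) (𝓝 P) ∧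
        Icosa.delta '' Icosa.SregUpper = Icosa.Tstar \ {P}) ∧
    Bornology.IsBounded Icosa.Tstar ∧
    -- the differential of `δ` carries `Γ` to the flat metric
    (∀ p ∈ Icosa.SregUpper, ∃ L : ℂ × ℂ →L[ℂ] ℂ,
        HasFDerivWithinAt Icosa.delta L Icosa.SregUpper p ∧
        ∀ v w : ℂ × ℂ, (p, v) ∈ Icosa.TSreg → (p, w) ∈ Icosa.TSreg →
          Icosa.Gam p v w = ⟪L v, L w⟫_ℝ) ∧
    -- under `δ`, geodesics correspond to straight segments in `T*`
    (∀ (c : ℝ → ℂ × ℂ) (J : Set ℝ), IsOpen J → J.OrdConnected → ContinuousOn c J →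
        (∀ t ∈ J, c t ∈ Icosa.SregUpper) →
        (Icosa.IsGeodesicOn c J ↔
          Icosa.IsStraightOn (fun t => Icosa.delta (c t)) J ∧
            ∀ t ∈ J, Icosa.delta (c t) ∈ Icosa.Tstar)) ∧
    -- the same on all of `S_reg`, for the local determinations of `δ`
    (∀ (V : Set ℂ) (D : ℂ → ℂ), Icosa.IsDetermination V D →
        (∀ (c : ℝ → ℂ × ℂ) (J : Set ℝ), IsOpen J → J.OrdConnected → ContinuousOn c J →
          (∀ t ∈ J, c t ∈ Icosa.Sreg ∧ (c t).1 ∈ V) →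
          (Icosa.IsGeodesicOn c J ↔ Icosa.IsStraightOn (fun t => D (c t).1) J)) ∧
        ∀ p ∈ Icosa.Sreg, p.1 ∈ V → ∀ α : ℂ, ∃ (ε : ℝ) (c : ℝ → ℂ × ℂ), 0 < ε ∧ c 0 = p ∧
          Icosa.IsGeodesicOn c (Ioo (-ε) ε) ∧
          ∀ t ∈ Ioo (-ε) ε, (c t).1 ∈ V ∧ D (c t).1 = D p.1 + (t : ℂ) * α) ∧
    -- the geodesic vector field is incomplete
    Icosa.IsIncomplete Icosa.geodesicField Icosa.TSreg := by
  refine ⟨⟨Icosa.ptP, Icosa.ptP_mem_openSegment, Icosa.tendsto_FT, Icosa.delta_image⟩,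
    Icosa.isBounded_Tstar, fun p hp => Icosa.exists_hasFDerivWithinAt_delta hp,
    fun c J hJ hJc hc hS => Icosa.isGeodesicOn_iff_delta hJ hJc hc hS,
    fun V D hD => ⟨fun c J hJ hJc hc hV => hD.isGeodesicOn_iff Icosa.k_pos.ne' hJ hJc hc hV,
      fun p hp hpV α => hD.exists_isGeodesicOn Icosa.k_pos.ne' hp hpV α⟩,
    Icosa.isIncomplete_geodesicField⟩
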